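/- Let $p$ be a prime, $m$ a natural number, and let $F_0$ be a field of characteristic $0$ or $\ge p$; if $\operatorname{char}(F_0)\neq p$, assume that $F_0$ contains a primitive $p$th root of unity $\rho$. Let $F$ be either the rational function field $F_0(\alpha_1,\beta_1,\dots,\alpha_m,\beta_m)$ in $2m$ independent variables or the iterated Laurent series field $F_0(\!(\alpha_1^{-1})\!)(\!(\beta_1^{-1})\!)\cdots(\!(\alpha_m^{-1})\!)(\!(\beta_m^{-1})\!)$. Let $A=A_1\otimes_F\cdots\otimes_F A_m$, where $$A_j=F\langle x,y : x^p=\alpha_j,\ y^p=\beta_j,\ yx=\rho xy\rangle \quad\text{if } \operatorname{char}(F_0)\neq p,$$ $$A_j=F\langle x,y : x^p-x=\alpha_j,\ y^p=\beta_j,\ yx=(x+1)y\rangle \quad\text{if } \operatorname{char}(F_0)=p.$$ Let $d=p^m$ be the degree of the central simple $F$-algebra $A$, and for $v\in A$ let $f_1(v),\dots,f_d(v)\in F$ be its characteristic coefficients, that is, the characteristic polynomial of the image of $v$ under an isomorphism $A\otimes_F \overline{F}\cong M_d(\overline{F})$ is $X^d+f_1(v)X^{d-1}+\cdots+f_d(v)$.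 Then every $F$-subspace $V$ of $A$ such that $f_i(v)=0$ for all $v\in V$ and all $1\le i\le p-1$ with $i\le d$ satisfies $\dim_F V\le \frac{p^{2m}-1}{p-1}$. -/

import Mathlib

open scoped TensorProduct

universe u

/-- A field extension of `F₀` together with two families of `m` elements (the slots). -/
structure SlotField (F₀ : Type u) [Field F₀] (m : ℕ) where
  carrier : Type u
  [field : Field carrier]
  [algebra : Algebra F₀ carrier]
  α : Fin m → carrier
  β : Fin m → carrier

namespace SlotField

attribute [instance] SlotField.field SlotField.algebra

instance (F₀ : Type u) [Field F₀] (m : ℕ) : CoeSort (SlotField F₀ m) (Type u) := ⟨carrier⟩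

/-- The rational function field `F₀(α₁, β₁, …, αₘ, βₘ)` in `2m` independent variables. -/
noncomputable def rational (F₀ : Type u) [Field F₀] (m : ℕ) : SlotField F₀ m where
  carrier := FractionRing (MvPolynomial (Fin m ⊕ Fin m) F₀)
  α i := algebraMap (MvPolynomial (Fin m ⊕ Fin m) F₀) _ (MvPolynomial.X (Sum.inl i))
  β i := algebraMap (MvPolynomial (Fin m ⊕ Fin m) F₀) _ (MvPolynomial.X (Sum.inr i))

/-- The iterated Laurent series field `F₀((α₁⁻¹))((β₁⁻¹))…((αₘ⁻¹))((βₘ⁻¹))`. At each step the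
uniformizers `single 1 1` of the two new Laurent series fields are `α⁻¹` and `β⁻¹`, so the new
slots are `α = single (-1) 1` (viewed as a constant in the outer field) and `β = single (-1) 1`. -/
noncomputable def laurent (F₀ : Type u) [Field F₀] : (m : ℕ) → SlotField F₀ m
  | 0 => { carrier := F₀, α := Fin.elim0, β := Fin.elim0 }
  | m + 1 =>
    let K := (laurent F₀ m).carrier
    { carrier := LaurentSeries (LaurentSeries K)
      α := Fin.snoc (α := fun _ => LaurentSeries (LaurentSeries K))
        (fun i => HahnSeries.C (HahnSeries.C ((laurent F₀ m).α i)))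
        (HahnSeries.C (HahnSeries.single (-1) 1))
      β := Fin.snoc (α := fun _ => LaurentSeries (LaurentSeries K))
        (fun i => HahnSeries.C (HahnSeries.C ((laurent F₀ m).β i)))
        (HahnSeries.single (-1) 1) }

end SlotField

section Symbol

variable {F : Type u} [Field F]

/-- The relations `x ^ p = α`, `y ^ p = β`, `y x = ρ x y` on the free algebra on `x` (index `0`)
and `y` (index `1`). -/
inductive SymbolRel (p : ℕ) (ρ α β : F) : FreeAlgebra F (Fin 2) → FreeAlgebra F (Fin 2) → Prop
  | x_pow : SymbolRel p ρ α β (FreeAlgebra.ι F 0 ^ p) (algebraMap F _ α)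
  | y_pow : SymbolRel p ρ α β (FreeAlgebra.ι F 1 ^ p) (algebraMap F _ β)
  | comm : SymbolRel p ρ α β (FreeAlgebra.ι F 1 * FreeAlgebra.ι F 0)
      (ρ • (FreeAlgebra.ι F 0 * FreeAlgebra.ι F 1))

/-- The symbol algebra `(α, β)_{p,F}` with respect to the primitive `p`-th root of unity `ρ`
(for fields of characteristic different from `p`, and `α`, `β` nonzero). -/
abbrev SymbolAlgebra (p : ℕ) (ρ α β : F) : Type u := RingQuot (SymbolRel p ρ α β)

/-- The relations `x ^ p - x = α`, `y ^ p = β`, `y x = (x + 1) y` on the free algebra on `x`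
(index `0`) and `y` (index `1`). -/
inductive SymbolRelCharP (p : ℕ) (α β : F) : FreeAlgebra F (Fin 2) → FreeAlgebra F (Fin 2) → Prop
  | x_pow : SymbolRelCharP p α β (FreeAlgebra.ι F 0 ^ p - FreeAlgebra.ι F 0) (algebraMap F _ α)
  | y_pow : SymbolRelCharP p α β (FreeAlgebra.ι F 1 ^ p) (algebraMap F _ β)
  | comm : SymbolRelCharP p α β (FreeAlgebra.ι F 1 * FreeAlgebra.ι F 0)
      ((FreeAlgebra.ι F 0 + 1) * FreeAlgebra.ι F 1)

/-- The symbol algebra `[α, β)_{p,F}` (for fields of characteristic `p`, and `β` nonzero). -/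
abbrev SymbolAlgebraCharP (p : ℕ) (α β : F) : Type u := RingQuot (SymbolRelCharP p α β)

end Symbol

section CharCoeff

variable (F : Type*) [Field F] {A : Type*} [Ring A] [Algebra F A]

/-- `c : F` is the coefficient of `X ^ (d - i)` in the characteristic polynomial of `a` computed
through an isomorphism of `K ⊗ A` with `M_d(K)`, where `K` is the algebraic closure of `F`. -/
def IsCharCoeff (i : ℕ) (a : A) (c : F) : Prop :=
  ∃ (d : ℕ) (φ : AlgebraicClosure F ⊗[F] A ≃ₐ[AlgebraicClosure F]
      Matrix (Fin d) (Fin d) (AlgebraicClosure F)),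
    i ≤ d ∧ (φ (1 ⊗ₜ[F] a)).charpoly.coeff (d - i) = algebraMap F (AlgebraicClosure F) c

open Classical in
/-- The `i`-th characteristic coefficient `f_i : A → F` of a central simple `F`-algebra `A` of
degree `d`, for `i ≤ d`: the reduced characteristic polynomial of `a` is
`X ^ d + f_1(a) X ^ (d - 1) + ⋯ + f_d(a)`. (The value is `0` where this is undefined.) -/
noncomputable def charCoeff (i : ℕ) (a : A) : F :=
  if h : ∃ c : F, IsCharCoeff F i a c then h.choose else 0

end CharCoeff

/-! By Newton's identities, and since `(p - 1)!` is invertible, the vanishing of `f_1, …, f_{p-1}`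
at `v` gives `Tr(v^(p-1)) = 0` when `m > 0`. In the basis of monomials in the generators, indexed by
`(ℤ/p)^(2m)`, the reduced trace is a nonzero multiple of one coordinate `t`: `t = 0` if the
characteristic is not `p`; otherwise `t` is `-1` on the `x`-exponents and `0` on the `y`-exponents.
As `F` is infinite for `m > 0`, polarization kills the `t`-coordinate of the sum of all products of
`i` factors `v` and `j` factors `w`, for `i + j = p - 1` and `v, w ∈ V`.

`F` has a valuation, trivial on `F₀`, for which the values of the slots are independent modulo `p`.
Extended to the algebraic closure, it gives the monomials values that are distinct modulo the value
group of `F`, so every nonzero element has one leading index. Let `S` be the set of leading indices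
of `V`. The coordinates in `S` separate the elements of `V`, so `dim V ≤ |S|`. Leading parts
multiply like the matrices `clockShift`. If those at `s, s' ∈ S` commute, the mixed product has
leading index `i s + j s'`, because `(p-1).choose j` has value `1`; hence `i s + j s' ≠ t`
(`IsTame.repr_mixedProduct_ne_zero`). In characteristic `p` they always commute; otherwise `t = 0`
and proportional indices suffice.

Since `i + j = -1` modulo `p`, the equation `i s + j s' = t` says `i (s + t) + j (s' + t) = 0`. So
`S + t` avoids `0` and meets each line through `0` at most once (`card_le_of_nsmul_add_nsmul_ne`);
there are `(p^(2m) - 1)/(p - 1)` lines. -/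

/-! ### Newton's identities for the characteristic polynomial -/

namespace Matrix

open Polynomial

variable {n R : Type*} [Fintype n] [DecidableEq n] [CommRing R]

/-- The product rule on the Leibniz expansion: differentiating one row of `X - M` leaves a row of
the identity, which is the row that defines a diagonal entry of the adjugate. -/
theorem derivative_charpoly (M : Matrix n n R) :
    derivative M.charpoly = (charmatrix M).adjugate.trace := by
  have key : ∀ i, (charmatrix M).adjugate i i = ∑ σ : Equiv.Perm n, (Equiv.Perm.sign σ : ℤ) •
      ((∏ j ∈ Finset.univ.erase i, charmatrix M j (σ j)) *
        derivative (charmatrix M i (σ i))) := by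
    intro i
    rw [adjugate_apply, ← det_transpose, det_apply]
    refine Finset.sum_congr rfl fun σ _ => ?_
    rw [Units.smul_def, ← Finset.prod_erase_mul _ _ (Finset.mem_univ i)]
    congr 2
    · refine Finset.prod_congr rfl fun j hj => ?_
      rw [transpose_apply, updateRow_ne (Finset.ne_of_mem_erase hj)]
    · rw [transpose_apply, updateRow_self, charmatrix_apply, Pi.single_apply, diagonal_apply]
      by_cases h : i = σ i
      · simp [if_pos h, if_pos h.symm]
      · simp [if_neg h, if_neg (Ne.symm h)]
  rw [charpoly, ← det_transpose, det_apply, derivative_sum, trace]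
  simp only [diag_apply, key]
  rw [Finset.sum_comm]
  refine Finset.sum_congr rfl fun σ _ => ?_
  rw [Units.smul_def, derivative_smul, ← Finset.smul_sum]
  congr 1
  exact derivative_prod_finset

/-- Compare coefficients in `adj(X - M) (X - M) = charpoly`, as in the proof of Cayley–Hamilton;
iteration is Horner's scheme. -/
theorem matPolyEquiv_adjugate_coeff (M : Matrix n n R) (k : ℕ) :
    (matPolyEquiv (charmatrix M).adjugate).coeff k =
      M.charpoly.coeff (k + 1) • (1 : Matrix n n R) +
        (matPolyEquiv (charmatrix M).adjugate).coeff (k + 1) * M := by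
  have h := congrArg (fun q => (matPolyEquiv q).coeff (k + 1)) (adjugate_mul (charmatrix M))
  simp only [map_mul, matPolyEquiv_charmatrix, mul_sub, coeff_sub, coeff_mul_X, coeff_mul_C] at h
  rw [← charpoly, matPolyEquiv_smul_one, coeff_map] at h
  rw [sub_eq_iff_eq_add] at h
  rw [h, ← Algebra.algebraMap_eq_smul_one]

theorem matPolyEquiv_adjugate_coeff_eq_sum (M : Matrix n n R) (k N : ℕ) :
    (matPolyEquiv (charmatrix M).adjugate).coeff k =
      ∑ i ∈ Finset.range N, M.charpoly.coeff (k + 1 + i) • M ^ i +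
        (matPolyEquiv (charmatrix M).adjugate).coeff (k + N) * M ^ N := by
  induction N with
  | zero => simp
  | succ N ih =>
    rw [ih, Finset.sum_range_succ, matPolyEquiv_adjugate_coeff M (k + N), add_mul, smul_mul_assoc,
      one_mul, mul_assoc, ← pow_succ', add_assoc (Finset.sum _ _), add_assoc k 1 N,
      add_comm 1 N, add_assoc k N 1]

theorem charpoly_coeff_newton (M : Matrix n n R) {k N : ℕ} (hN : Fintype.card n ≤ k + N) :
    ((k + 1 : ℕ) : R) * M.charpoly.coeff (k + 1) =
      ∑ i ∈ Finset.range N, M.charpoly.coeff (k + 1 + i) * (M ^ i).trace := by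
  nontriviality R
  have htr : (((k + 1 : ℕ) : R) * M.charpoly.coeff (k + 1)) =
      ((matPolyEquiv (charmatrix M).adjugate).coeff k).trace := by
    have := congrArg (fun q => coeff q k) (derivative_charpoly M)
    simp only [coeff_derivative] at this
    push_cast
    rw [mul_comm, this, trace, trace, finsetSum_coeff]
    simp [matPolyEquiv_coeff_apply]
  -- Beyond the degree of the adjugate the Horner remainder vanishes; the extra terms vanish by the
  -- degree of the characteristic polynomial.
  obtain ⟨N', hN', h0⟩ : ∃ N', N ≤ N' ∧
      (matPolyEquiv (charmatrix M).adjugate).coeff (k + N') = 0 := by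
    refine ⟨N + (matPolyEquiv (charmatrix M).adjugate).natDegree + 1, by omega, ?_⟩
    exact coeff_eq_zero_of_natDegree_lt (by omega)
  rw [htr, matPolyEquiv_adjugate_coeff_eq_sum M k N', h0, zero_mul, add_zero, trace_sum]
  rw [← Finset.sum_subset (Finset.range_mono hN')]
  · simp [trace_smul]
  · intro i _ hi
    have : M.charpoly.coeff (k + 1 + i) = 0 := by
      apply coeff_eq_zero_of_natDegree_lt
      rw [charpoly_natDegree_eq_dim]
      simp at hi
      omega
    simp [this]

end Matrix

/-! ### Characteristic coefficients and traces -/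

/-- Isomorphisms of matrix algebras over a field are conjugations (Skolem–Noether). -/
theorem AlgEquiv.charpoly_matrix_apply {K n n' : Type*} [Field K] [Fintype n] [DecidableEq n]
    [Fintype n'] [DecidableEq n'] (f : Matrix n n K ≃ₐ[K] Matrix n' n' K) (M : Matrix n n K) :
    (f M).charpoly = M.charpoly := by
  obtain ⟨T, hT⟩ := AlgEquiv.eq_linearEquivConjAlgEquiv
    ((Matrix.toLinAlgEquiv'.symm.trans f).trans Matrix.toLinAlgEquiv')
  have h := DFunLike.congr_fun hT (Matrix.toLinAlgEquiv' M)
  rw [AlgEquiv.trans_apply, AlgEquiv.trans_apply, AlgEquiv.symm_apply_apply] at h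
  have h1 : (Matrix.toLin' (f M)).charpoly = (T.conj (Matrix.toLin' M)).charpoly :=
    congrArg LinearMap.charpoly h
  rw [LinearEquiv.charpoly_conj, Matrix.charpoly_toLin', Matrix.charpoly_toLin'] at h1
  exact h1

section

variable {F A I : Type*} [Field F] [Ring A] [Algebra F A] [Fintype I] [DecidableEq I]

/-- Neither the splitting nor the size `d` matters: the degree of the characteristic polynomial
recovers `d`. -/
theorem isCharCoeff_iff
    (φ : AlgebraicClosure F ⊗[F] A ≃ₐ[AlgebraicClosure F] Matrix I I (AlgebraicClosure F))
    (i : ℕ) (a : A) (c : F) : IsCharCoeff F i a c ↔ i ≤ Fintype.card I ∧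
      (φ (1 ⊗ₜ[F] a)).charpoly.coeff (Fintype.card I - i) =
        algebraMap F (AlgebraicClosure F) c := by
  constructor
  · rintro ⟨d, ψ, hi, h⟩
    have h1 := AlgEquiv.charpoly_matrix_apply (ψ.symm.trans φ) (ψ (1 ⊗ₜ[F] a))
    have hd : Fintype.card I = d := by
      have := congrArg Polynomial.natDegree h1
      simpa [Matrix.charpoly_natDegree_eq_dim] using this
    simp only [AlgEquiv.trans_apply, AlgEquiv.symm_apply_apply] at h1
    rw [h1, hd]
    exact ⟨hi, h⟩
  · rintro ⟨hi, h⟩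
    let e := Matrix.reindexAlgEquiv (AlgebraicClosure F) (AlgebraicClosure F) (Fintype.equivFin I)
    refine ⟨Fintype.card I, φ.trans e, hi, ?_⟩
    rw [AlgEquiv.trans_apply, AlgEquiv.charpoly_matrix_apply]
    exact h

theorem algebraMap_charCoeff
    (φ : AlgebraicClosure F ⊗[F] A ≃ₐ[AlgebraicClosure F] Matrix I I (AlgebraicClosure F))
    {i : ℕ} {a : A} (hi : i ≤ Fintype.card I)
    (h : ∃ c, algebraMap F (AlgebraicClosure F) c =
      (φ (1 ⊗ₜ[F] a)).charpoly.coeff (Fintype.card I - i)) :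
    algebraMap F (AlgebraicClosure F) (charCoeff F i a) =
      (φ (1 ⊗ₜ[F] a)).charpoly.coeff (Fintype.card I - i) := by
  obtain ⟨c, hc⟩ := h
  have hex : ∃ c, IsCharCoeff F i a c := ⟨c, (isCharCoeff_iff φ i a c).2 ⟨hi, hc.symm⟩⟩
  rw [charCoeff, dif_pos hex]
  exact ((isCharCoeff_iff φ i a _).1 hex.choose_spec).2.symm

/-- If the trace is defined over the base field, then so are the characteristic coefficients
`f_i` with `i !` invertible. -/
theorem charpoly_coeff_mem_range {K : Type*} [Field K] [Algebra F K] (M : Matrix I I K)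
    (htr : ∀ k, (M ^ k).trace ∈ (algebraMap F K).range) {i : ℕ}
    (hi : i < Fintype.card I) (hnat : ∀ k : ℕ, 0 < k → k ≤ i → (k : F) ≠ 0) :
    M.charpoly.coeff (Fintype.card I - i) ∈ (algebraMap F K).range := by
  induction i using Nat.strong_induction_on with
  | _ i ih =>
    rcases Nat.eq_zero_or_pos i with rfl | hpos
    · have : M.charpoly.coeff (Fintype.card I) = 1 := by
        rw [← M.charpoly_natDegree_eq_dim]
        exact M.charpoly_monic
      rw [Nat.sub_zero, this]
      exact one_mem _
    -- With `n` the matrix size, the term `Tr 1 = n` against the factor `n - i` leaves `-i` times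
    -- the wanted coefficient, and `i` is invertible.
    · have h := M.charpoly_coeff_newton (k := Fintype.card I - i - 1) (N := i + 1) (by omega)
      have e : Fintype.card I - i - 1 + 1 = Fintype.card I - i := by omega
      rw [e, Finset.sum_range_succ', add_zero, pow_zero, Matrix.trace_one,
        Nat.cast_sub hi.le] at h
      obtain ⟨c, hc⟩ : ∑ k ∈ Finset.range i, M.charpoly.coeff (Fintype.card I - i + (k + 1)) *
          (M ^ (k + 1)).trace ∈ (algebraMap F K).range := by
        refine sum_mem fun k hk => mul_mem ?_ (htr _)
        rw [Finset.mem_range] at hk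
        have e2 : Fintype.card I - i + (k + 1) = Fintype.card I - (i - (k + 1)) := by omega
        rw [e2]
        exact ih _ (by omega) (by omega) fun l hl hl' => hnat l hl (by omega)
      have hi0 : (i : K) ≠ 0 := by
        rw [← map_natCast (algebraMap F K)]
        exact (map_ne_zero _).2 (hnat i hpos le_rfl)
      refine ⟨-((i : F)⁻¹ * c), ?_⟩
      rw [map_neg, map_mul, map_inv₀, map_natCast, hc, neg_eq_iff_eq_neg,
        inv_mul_eq_iff_eq_mul₀ hi0]
      linear_combination -h

/-- In Newton's identity for `f_{p-1}`, only the leading coefficient `1` survives, and it multiplies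
the trace of `v ^ (p - 1)`. -/
theorem trace_pow_eq_zero_of_charCoeff_eq_zero {p : ℕ} (hp : p.Prime)
    (Φ : A →ₐ[F] Matrix I I (AlgebraicClosure F))
    (φ : AlgebraicClosure F ⊗[F] A ≃ₐ[AlgebraicClosure F] Matrix I I (AlgebraicClosure F))
    (hφ : ∀ a, φ (1 ⊗ₜ[F] a) = Φ a)
    (htr : ∀ a, (Φ a).trace ∈ (algebraMap F (AlgebraicClosure F)).range)
    (hnat : ∀ k : ℕ, 0 < k → k < p → (k : F) ≠ 0) (hI : p ≤ Fintype.card I) {v : A}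
    (hv : ∀ i ∈ Finset.Icc 1 (p - 1), charCoeff F i v = 0) :
    (Φ (v ^ (p - 1))).trace = 0 := by
  have h2 := hp.two_le
  -- `charCoeff` also takes the value `0` by default, so the coefficient must first be shown to lie
  -- in `F`.
  have hcoeff : ∀ i, 1 ≤ i → i ≤ p - 1 → (Φ v).charpoly.coeff (Fintype.card I - i) = 0 := by
    intro i h1 hi
    have := algebraMap_charCoeff φ (i := i) (a := v) (by omega) (by
      rw [hφ]
      exact charpoly_coeff_mem_range (Φ v) (fun k => by rw [← map_pow]; exact htr _) (by omega)
        fun k hk hk' => hnat k hk (by omega))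
    rw [hv i (Finset.mem_Icc.2 ⟨h1, hi⟩), map_zero, hφ] at this
    exact this.symm
  have h := (Φ v).charpoly_coeff_newton (k := Fintype.card I - (p - 1) - 1) (N := p) (by omega)
  have e : Fintype.card I - (p - 1) - 1 + 1 = Fintype.card I - (p - 1) := by omega
  rw [e, hcoeff (p - 1) (by omega) le_rfl, mul_zero, Finset.sum_eq_single (p - 1)] at h
  · have e2 : Fintype.card I - (p - 1) + (p - 1) = Fintype.card I := by omega
    have : (Φ v).charpoly.coeff (Fintype.card I) = 1 := by
      rw [← (Φ v).charpoly_natDegree_eq_dim]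
      exact (Φ v).charpoly_monic
    rw [e2, this, one_mul, ← map_pow] at h
    exact h.symm
  · intro i hi hne
    rw [Finset.mem_range] at hi
    have e3 : Fintype.card I - (p - 1) + i = Fintype.card I - (p - 1 - i) := by omega
    rw [e3, hcoeff (p - 1 - i) (by omega) (by omega), zero_mul]
  · intro h
    simp at h
    omega

/-- Needed for `m = 0`, where the degree is `1` and only `f_1` is available. -/
theorem trace_eq_zero_of_charCoeff_one_eq_zero
    (Φ : A →ₐ[F] Matrix I I (AlgebraicClosure F))
    (φ : AlgebraicClosure F ⊗[F] A ≃ₐ[AlgebraicClosure F] Matrix I I (AlgebraicClosure F))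
    (hφ : ∀ a, φ (1 ⊗ₜ[F] a) = Φ a)
    (htr : ∀ a, (Φ a).trace ∈ (algebraMap F (AlgebraicClosure F)).range) [Nonempty I] {v : A}
    (hv : charCoeff F 1 v = 0) : (Φ v).trace = 0 := by
  have h := algebraMap_charCoeff φ (i := 1) (a := v) Fintype.card_pos (by
    rw [hφ]
    obtain ⟨c, hc⟩ := htr v
    exact ⟨-c, by rw [map_neg, hc, Matrix.trace_eq_neg_charpoly_coeff, neg_neg]⟩)
  rw [Matrix.trace_eq_neg_charpoly_coeff, ← hφ, ← h, hv, map_zero, neg_zero]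

end

/-! ### Clock-and-shift representations -/

/-- A representation of an `F`-algebra by matrices over `K` in which a spanning family, indexed by
pairs of exponent vectors modulo `p`, acts by the monomial matrices of a product of `m` generic
symbol algebras: the first `m` generators act diagonally with eigenvalues `g j`, the last `m`
generators act as `η j` times a cyclic shift. -/
structure SymbolRep (p m : ℕ) (F K A : Type*) [Field F] [Field K] [Algebra F K] [Ring A]
    [Algebra F A] [NeZero p] where
  toHom : A →ₐ[F] Matrix (Fin m → ZMod p) (Fin m → ZMod p) K
  gen : (Fin m ⊕ Fin m → ZMod p) → A
  span_gen : Submodule.span F (Set.range gen) = ⊤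
  g : Fin m → ZMod p → K
  g_injective : ∀ j, Function.Injective (g j)
  η : Fin m → K
  η_ne_zero : ∀ j, η j ≠ 0
  toHom_gen : ∀ u i k, toHom (gen u) i k = if k = i + u ∘ Sum.inr then
    ∏ j, (g j (i j) ^ (u (Sum.inl j)).val * η j ^ (u (Sum.inr j)).val) else 0

theorem ZMod.sum_val_eq_sum_range {M : Type*} [AddCommMonoid M] (p : ℕ) [NeZero p] (f : ℕ → M) :
    ∑ a : ZMod p, f a.val = ∑ a ∈ Finset.range p, f a := by
  refine Finset.sum_nbij ZMod.val (fun a _ => Finset.mem_range.2 (ZMod.val_lt a))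
    (fun a _ b _ h => ZMod.val_injective p h) (fun a ha => ?_) (fun _ _ => rfl)
  exact ⟨(a : ZMod p), by simp, ZMod.val_cast_of_lt (by simpa using ha)⟩

/-- Lagrange interpolation: the eigenprojections of a clock matrix are polynomials in it. -/
theorem exists_coeff_eval_eq_single {K : Type*} [Field K] {p : ℕ} [NeZero p] {g : ZMod p → K}
    (hg : Function.Injective g) (i : ZMod p) :
    ∃ c : ZMod p → K, ∀ i', ∑ a, c a * g i' ^ a.val = if i' = i then 1 else 0 := by
  let L := Lagrange.basis Finset.univ g i
  have hdeg : L.natDegree < p := by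
    have h := Lagrange.natDegree_basis (s := Finset.univ) (v := g) (i := i)
      hg.injOn (Finset.mem_univ i)
    rw [Finset.card_univ, ZMod.card] at h
    have := NeZero.pos p
    change (Lagrange.basis Finset.univ g i).natDegree < p
    omega
  refine ⟨fun a => L.coeff a.val, fun i' => ?_⟩
  rw [ZMod.sum_val_eq_sum_range p (fun a => L.coeff a * g i' ^ a),
    ← Polynomial.eval_eq_sum_range' hdeg]
  split_ifs with h
  · rw [h]
    exact Lagrange.eval_basis_self hg.injOn (Finset.mem_univ i)
  · exact Lagrange.eval_basis_of_ne (Ne.symm h) (Finset.mem_univ _)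

namespace SymbolRep

variable {p m : ℕ} {F K A : Type*} [Field F] [Field K] [Algebra F K] [Ring A]
    [Algebra F A] [NeZero p] (R : SymbolRep p m F K A)

/-- Products of eigenprojections isolate row `i`, and the shift by `k - i` moves to column `k`, so
every matrix unit is reached. The family has `p^(2m)` members, hence is a basis. -/
theorem span_toHom_gen :
    Submodule.span K (Set.range fun u => R.toHom (R.gen u)) = ⊤ := by
  rw [eq_top_iff]
  have key : ∀ i k, Matrix.single i k (1 : K) ∈
      Submodule.span K (Set.range fun u => R.toHom (R.gen u)) := by
    intro i k
    choose c hc using fun j => exists_coeff_eval_eq_single (R.g_injective j) (i j)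
    have hη : ∏ j, R.η j ^ ((k - i) j).val ≠ 0 :=
      Finset.prod_ne_zero_iff.2 fun j _ => pow_ne_zero _ (R.η_ne_zero j)
    have : Matrix.single i k (1 : K) = (∏ j, R.η j ^ ((k - i) j).val)⁻¹ •
        ∑ a : Fin m → ZMod p, (∏ j, c j (a j)) • R.toHom (R.gen (Sum.elim a (k - i))) := by
      ext i' k'
      simp only [Matrix.smul_apply, Matrix.sum_apply, R.toHom_gen, Sum.elim_inl, Sum.elim_inr,
        Sum.elim_comp_inr, smul_eq_mul, Finset.prod_mul_distrib, mul_ite, mul_zero]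
      by_cases hk : k' = i' + (k - i)
      · simp only [if_pos hk, ← mul_assoc, ← Finset.prod_mul_distrib]
        simp only [Finset.prod_mul_distrib (g := fun j => R.η j ^ ((k - i) j).val)]
        rw [← Finset.sum_mul, ← Fintype.prod_sum fun j a => c j a * R.g j (i' j) ^ a.val,
          mul_comm, mul_assoc, mul_inv_cancel₀ hη, mul_one]
        simp only [hc]
        rw [Matrix.single_apply]
        by_cases hi : i' = i
        · subst hi
          simp [hk]
        · rw [if_neg (by tauto)]
          obtain ⟨j, hj⟩ := Function.ne_iff.1 hi
          exact (Finset.prod_eq_zero (Finset.mem_univ j) (if_neg hj)).symm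
      · simp only [if_neg hk, Finset.sum_const_zero, mul_zero]
        rw [Matrix.single_apply, if_neg]
        rintro ⟨rfl, rfl⟩
        simp at hk
    rw [this]
    exact Submodule.smul_mem _ _ (Submodule.sum_mem _ fun a _ => Submodule.smul_mem _ _
      (Submodule.subset_span ⟨_, rfl⟩))
  intro M _
  rw [Matrix.matrix_eq_sum_single M]
  refine Submodule.sum_mem _ fun i _ => Submodule.sum_mem _ fun k _ => ?_
  have := Submodule.smul_mem _ (M i k) (key i k)
  rwa [Matrix.smul_single, smul_eq_mul, mul_one] at this

theorem linearIndependent_toHom_gen : LinearIndependent K fun u => R.toHom (R.gen u) := by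
  refine linearIndependent_of_top_le_span_of_card_eq_finrank R.span_toHom_gen.ge ?_
  simp [Module.finrank_matrix, pow_add]

theorem linearIndependent_gen : LinearIndependent F R.gen := by
  have h := R.linearIndependent_toHom_gen.restrict_scalars (R := F)
    (by simpa [Algebra.smul_def] using (algebraMap F K).injective)
  exact h.of_comp R.toHom.toLinearMap

/-- The spanning family of a `SymbolRep` is a basis. -/
noncomputable def basis : Module.Basis (Fin m ⊕ Fin m → ZMod p) F A :=
  Module.Basis.mk R.linearIndependent_gen R.span_gen.ge

@[simp]
theorem basis_apply (u) : R.basis u = R.gen u := by simp [basis]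

theorem exists_algEquiv : ∃ φ : K ⊗[F] A ≃ₐ[K] Matrix (Fin m → ZMod p) (Fin m → ZMod p) K,
    ∀ a, φ (1 ⊗ₜ[F] a) = R.toHom a := by
  let ψ : K ⊗[F] A →ₐ[K] Matrix (Fin m → ZMod p) (Fin m → ZMod p) K :=
    Algebra.TensorProduct.lift (Algebra.ofId _ _) R.toHom fun _ _ => Algebra.commutes _ _
  have hψ : ∀ a, ψ (1 ⊗ₜ[F] a) = R.toHom a := fun a =>
    (Algebra.TensorProduct.lift_tmul _ _ _ _ _).trans (by rw [map_one, one_mul])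
  have hb : Function.Bijective ψ := by
    let B := R.basis.baseChange K
    have : ψ.toLinearMap = (B.equiv (Module.Basis.mk R.linearIndependent_toHom_gen
        R.span_toHom_gen.ge) (Equiv.refl _)).toLinearMap := by
      refine B.ext fun u => ?_
      rw [LinearEquiv.coe_coe, Module.Basis.equiv_apply, Module.Basis.mk_apply]
      simp [B, hψ]
    have h2 : (ψ : K ⊗[F] A → _) = (B.equiv (Module.Basis.mk R.linearIndependent_toHom_gen
        R.span_toHom_gen.ge) (Equiv.refl _)) := funext fun x => LinearMap.congr_fun this x
    rw [h2]
    exact LinearEquiv.bijective _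
  exact ⟨AlgEquiv.ofBijective ψ hb, hψ⟩

end SymbolRep

/-! ### Polarization of powers -/

section MixedProduct

/-- The sum of all products of `i` factors `a` and `j` factors `b`, in any order. -/
def mixedProduct {A : Type*} [Semiring A] (a b : A) : ℕ → ℕ → A
  | 0, 0 => 1
  | i + 1, 0 => a * mixedProduct a b i 0
  | 0, j + 1 => b * mixedProduct a b 0 j
  | i + 1, j + 1 => a * mixedProduct a b i (j + 1) + b * mixedProduct a b (i + 1) j

theorem map_mixedProduct {A B G : Type*} [Semiring A] [Semiring B] [FunLike G A B]
    [RingHomClass G A B] (f : G) (a b : A) (i j : ℕ) :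
    f (mixedProduct a b i j) = mixedProduct (f a) (f b) i j := by
  induction i, j using mixedProduct.induct with
  | case1 => simp [mixedProduct]
  | case2 i ih => simp [mixedProduct, ih]
  | case3 j ih => simp [mixedProduct, ih]
  | case4 i j ih1 ih2 => simp [mixedProduct, ih1, ih2]

theorem mixedProduct_of_commute {A : Type*} [Semiring A] {a b : A} (h : Commute a b) (i j : ℕ) :
    mixedProduct a b i j = (i + j).choose j • (a ^ i * b ^ j) := by
  induction i, j using mixedProduct.induct with
  | case1 => simp [mixedProduct]
  | case2 i ih => simp [mixedProduct, ih, pow_succ']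
  | case3 j ih => simp [mixedProduct, ih, pow_succ']
  | case4 i j ih1 ih2 =>
    have e1 : a * (a ^ i * b ^ (j + 1)) = a ^ (i + 1) * b ^ (j + 1) := by
      rw [← mul_assoc, ← pow_succ']
    have e2 : b * (a ^ (i + 1) * b ^ j) = a ^ (i + 1) * b ^ (j + 1) := by
      rw [← mul_assoc, ← (h.pow_left (i + 1)).eq, mul_assoc, ← pow_succ']
    rw [mixedProduct, ih1, ih2, mul_smul_comm, mul_smul_comm, e1, e2, ← add_smul]
    congr 1
    rw [show i + 1 + (j + 1) = (i + j + 1) + 1 by ring, Nat.choose_succ_succ,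
      show i + (j + 1) = i + j + 1 by ring, show i + 1 + j = i + j + 1 by ring, add_comm]

theorem add_smul_pow_eq_sum_mixedProduct {F A : Type*} [CommSemiring F] [Semiring A] [Algebra F A]
    (a b : A) (c : F) (n : ℕ) : (a + c • b) ^ n =
      ∑ x ∈ Finset.HasAntidiagonal.antidiagonal n, c ^ x.2 • mixedProduct a b x.1 x.2 := by
  induction n with
  | zero => simp [mixedProduct]
  | succ n ih =>
    let u : ℕ × ℕ → A := fun x => match x with
      | (0, _) => 0
      | (i + 1, j) => c ^ j • (a * mixedProduct a b i j)
    let w : ℕ × ℕ → A := fun x => match x with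
      | (_, 0) => 0
      | (i, j + 1) => c ^ (j + 1) • (b * mixedProduct a b i j)
    have huw : ∀ x ∈ Finset.HasAntidiagonal.antidiagonal (n + 1),
        c ^ x.2 • mixedProduct a b x.1 x.2 = u x + w x := by
      rintro ⟨_ | i, _ | j⟩ hx
      · simp at hx
      · simp [u, w, mixedProduct]
      · simp [u, w, mixedProduct]
      · simp [u, w, mixedProduct]
    rw [Finset.sum_congr rfl huw, Finset.sum_add_distrib, Finset.Nat.sum_antidiagonal_succ,
      Finset.Nat.sum_antidiagonal_succ', pow_succ', ih, add_mul]
    simp only [u, w, Finset.mul_sum, zero_add]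
    congr 1
    · exact Finset.sum_congr rfl fun x _ => by rw [mul_smul_comm]
    · refine Finset.sum_congr rfl fun x _ => ?_
      rw [smul_mul_assoc, mul_smul_comm, smul_smul, ← pow_succ']

/-- `T ((a + c b) ^ n)` is a polynomial in `c` with these values as coefficients, and it vanishes on
an infinite field. -/
theorem map_mixedProduct_eq_zero {F A : Type*} [Field F] [Infinite F] [Ring A] [Algebra F A]
    (T : A →ₗ[F] F) (a b : A) (n : ℕ) (h : ∀ c : F, T ((a + c • b) ^ n) = 0) {i j : ℕ}
    (hij : i + j = n) : T (mixedProduct a b i j) = 0 := by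
  let P : Polynomial F := ∑ x ∈ Finset.HasAntidiagonal.antidiagonal n,
    Polynomial.monomial x.2 (T (mixedProduct a b x.1 x.2))
  have hP : P = 0 := by
    refine Polynomial.funext fun c => ?_
    rw [Polynomial.eval_zero, ← h c, add_smul_pow_eq_sum_mixedProduct, map_sum,
      Polynomial.eval_finsetSum]
    refine Finset.sum_congr rfl fun x _ => ?_
    rw [Polynomial.eval_monomial, map_smul, smul_eq_mul, mul_comm]
  have h2 := congrArg (fun q => Polynomial.coeff q j) hP
  simp only [P, Polynomial.finsetSum_coeff, Polynomial.coeff_zero, Polynomial.coeff_monomial] at h2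
  rw [Finset.sum_eq_single (i, j)] at h2
  · simpa using h2
  · rintro ⟨i', j'⟩ hx hne
    rw [Finset.HasAntidiagonal.mem_antidiagonal] at hx
    refine if_neg fun h => hne ?_
    simp only at h hx
    rw [Prod.mk.injEq]
    omega
  · intro hx
    simp [hij] at hx

end MixedProduct

/-! ### Leading terms of matrices with respect to a valuation -/

section Dominance

variable {K Γ : Type*} [Field K] [LinearOrderedCommGroupWithZero Γ] (ν : Valuation K Γ)

theorem Valuation.mul_sub_mul_lt {x y x' y' : K} (h : ν (x - y) < ν y)
    (h' : ν (x' - y') < ν y') : ν (x * x' - y * y') < ν (y * y') := by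
  have hy : 0 < ν y := lt_of_le_of_lt zero_le h
  have hy' : 0 < ν y' := lt_of_le_of_lt zero_le h'
  have e : x * x' - y * y' = (x - y) * x' + y * (x' - y') := by ring
  rw [e]
  refine ν.map_add_lt ?_ ?_
  · rw [map_mul, map_mul, ν.map_eq_of_sub_lt h']
    exact mul_lt_mul_of_pos_right h hy'
  · rw [map_mul, map_mul]
    exact mul_lt_mul_of_pos_left h' hy

theorem Valuation.prod_sub_prod_lt {ι : Type*} (s : Finset ι) {x y : ι → K}
    (h : ∀ i ∈ s, ν (x i - y i) < ν (y i)) :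
    ν (∏ i ∈ s, x i - ∏ i ∈ s, y i) < ν (∏ i ∈ s, y i) := by
  classical
  induction s using Finset.induction_on with
  | empty => simp
  | insert i s hi ih =>
    rw [Finset.prod_insert hi, Finset.prod_insert hi]
    exact ν.mul_sub_mul_lt (h _ (Finset.mem_insert_self _ _))
      (ih fun k hk => h _ (Finset.mem_insert_of_mem hk))

theorem Valuation.pow_sub_pow_lt {x y : K} (h : ν (x - y) < ν y) (n : ℕ) :
    ν (x ^ n - y ^ n) < ν (y ^ n) := by
  simpa using ν.prod_sub_prod_lt (Finset.range n) (x := fun _ => x) (y := fun _ => y)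
    fun _ _ => h

variable {I : Type*}

/-- All entries of `Z₀` have value at most `γ`, and those of `Z - Z₀` have smaller value. -/
structure Matrix.HasLead (Z Z₀ : Matrix I I K) (γ : Γ) : Prop where
  le : ∀ i k, ν (Z₀ i k) ≤ γ
  lt : ∀ i k, ν (Z i k - Z₀ i k) < γ

namespace Matrix.HasLead

variable {ν} {Z Z₀ Z' Z₀' : Matrix I I K} {γ γ' : Γ}

theorem le_left (h : HasLead ν Z Z₀ γ) (i k : I) : ν (Z i k) ≤ γ := by
  have := ν.map_add_le (h.lt i k).le (h.le i k)
  rwa [sub_add_cancel] at this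

theorem add (h : HasLead ν Z Z₀ γ) (h' : HasLead ν Z' Z₀' γ) :
    HasLead ν (Z + Z') (Z₀ + Z₀') γ where
  le i k := ν.map_add_le (h.le i k) (h'.le i k)
  lt i k := by
    rw [add_apply, add_apply, add_sub_add_comm]
    exact ν.map_add_lt (h.lt i k) (h'.lt i k)

theorem mul [Fintype I] (h : HasLead ν Z Z₀ γ) (h' : HasLead ν Z' Z₀' γ') :
    HasLead ν (Z * Z') (Z₀ * Z₀') (γ * γ') where
  le i k := by
    rw [mul_apply]
    refine ν.map_sum_le fun l _ => ?_
    rw [map_mul]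
    exact mul_le_mul' (h.le i l) (h'.le l k)
  lt i k := by
    have hγ : 0 < γ := lt_of_le_of_lt zero_le (h.lt i k)
    have hγ' : 0 < γ' := lt_of_le_of_lt zero_le (h'.lt i k)
    rw [mul_apply, mul_apply, ← Finset.sum_sub_distrib]
    refine ν.map_sum_lt' (mul_pos hγ hγ') fun l _ => ?_
    have e : Z i l * Z' l k - Z₀ i l * Z₀' l k =
        (Z i l - Z₀ i l) * Z' l k + Z₀ i l * (Z' l k - Z₀' l k) := by ring
    rw [e]
    refine ν.map_add_lt ?_ ?_
    · rw [map_mul]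
      exact mul_lt_mul_of_lt_of_le_of_nonneg_of_pos (h.lt i l) (h'.le_left l k) zero_le hγ'
    · rw [map_mul]
      exact mul_lt_mul_of_le_of_lt_of_nonneg_of_pos (h.le i l) (h'.lt l k) zero_le hγ

theorem one [DecidableEq I] : HasLead ν (1 : Matrix I I K) 1 1 where
  le i k := by
    rw [one_apply]
    split_ifs <;> simp
  lt i k := by simp

theorem mixedProduct [Fintype I] [DecidableEq I] (h : HasLead ν Z Z₀ γ)
    (h' : HasLead ν Z' Z₀' γ') (i j : ℕ) :
    HasLead ν (_root_.mixedProduct Z Z' i j) (_root_.mixedProduct Z₀ Z₀' i j) (γ ^ i * γ' ^ j) := by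
  induction i, j using mixedProduct.induct with
  | case1 => simpa [_root_.mixedProduct] using HasLead.one
  | case2 i ih => simpa [_root_.mixedProduct, pow_succ'] using h.mul ih
  | case3 j ih => simpa [_root_.mixedProduct, pow_succ'] using h'.mul ih
  | case4 i j ih1 ih2 =>
    have h1 := h.mul ih1
    have h2 := h'.mul ih2
    rw [← mul_assoc, ← pow_succ'] at h1
    rw [mul_left_comm, ← pow_succ'] at h2
    simpa only [_root_.mixedProduct] using h1.add h2

end Matrix.HasLead

end Dominance

/-! ### Multiplication of the leading matrices -/

section ClockShift

variable {p m : ℕ} {K : Type*} [Field K] (χ : AddChar (ZMod p) K)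

/-- The monomial matrix that multiplies the shift by `u ∘ inr` with the character
`i ↦ χ (u ∘ inl ⬝ᵥ i)`. -/
def clockShift (u : Fin m ⊕ Fin m → ZMod p) :
    Matrix (Fin m → ZMod p) (Fin m → ZMod p) K :=
  Matrix.of fun i k => if k = i + u ∘ Sum.inr then χ ((u ∘ Sum.inl) ⬝ᵥ i) else 0

theorem clockShift_apply (u : Fin m ⊕ Fin m → ZMod p) (i k : Fin m → ZMod p) :
    clockShift χ u i k = if k = i + u ∘ Sum.inr then χ ((u ∘ Sum.inl) ⬝ᵥ i) else 0 := rfl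

theorem clockShift_zero : clockShift χ (0 : Fin m ⊕ Fin m → ZMod p) = 1 := by
  ext i k
  simp [clockShift_apply, Matrix.one_apply, eq_comm]

theorem AddChar.pow_eq_one (x : ZMod p) : χ x ^ p = 1 := by
  rw [← AddChar.map_nsmul_eq_pow]
  simp

theorem AddChar.map_sum_eq_prod {ι A M : Type*} [AddCommMonoid A] [CommMonoid M] (ψ : AddChar A M)
    (s : Finset ι) (f : ι → A) : ψ (∑ i ∈ s, f i) = ∏ i ∈ s, ψ (f i) := by
  classical
  induction s using Finset.induction_on with
  | empty => simp
  | insert i s hi ih => rw [Finset.sum_insert hi, Finset.prod_insert hi, map_add_eq_mul, ih]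

variable [NeZero p]

/-- The scalar comes from moving the clock of `w` past the shift of `u`. -/
theorem clockShift_mul (u w : Fin m ⊕ Fin m → ZMod p) :
    clockShift χ u * clockShift χ w =
      χ ((w ∘ Sum.inl) ⬝ᵥ (u ∘ Sum.inr)) • clockShift χ (u + w) := by
  ext i k
  rw [Matrix.mul_apply, Finset.sum_eq_single (i + u ∘ Sum.inr)]
  · simp only [clockShift_apply, Matrix.smul_apply, if_true, Pi.add_comp, smul_eq_mul, mul_ite,
      mul_zero, dotProduct_add, add_dotProduct, AddChar.map_add_eq_mul, add_assoc]
    split_ifs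
    · ring
    · rfl
  · intro l _ hl
    rw [clockShift_apply, if_neg hl, zero_mul]
  · simp

theorem Valuation.map_addChar {Γ : Type*} [LinearOrderedCommGroupWithZero Γ] (ν : Valuation K Γ)
    (x : ZMod p) : ν (χ x) = 1 := by
  have h : ν (χ x) ^ p = 1 := by rw [← map_pow, AddChar.pow_eq_one, map_one]
  exact (pow_eq_one_iff_of_nonneg zero_le (NeZero.ne p)).1 h

theorem clockShift_pow (u : Fin m ⊕ Fin m → ZMod p) (n : ℕ) :
    ∃ x, clockShift χ u ^ n = χ x • clockShift χ (n • u) := by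
  induction n with
  | zero => exact ⟨0, by simp [clockShift_zero]⟩
  | succ n ih =>
    obtain ⟨x, hx⟩ := ih
    refine ⟨x + ((u ∘ Sum.inl) ⬝ᵥ ((n • u) ∘ Sum.inr)), ?_⟩
    rw [pow_succ, hx, smul_mul_assoc, clockShift_mul, smul_smul, AddChar.map_add_eq_mul, succ_nsmul]

theorem clockShift_pow_mul_pow (u w : Fin m ⊕ Fin m → ZMod p) (i j : ℕ) :
    ∃ x, clockShift χ u ^ i * clockShift χ w ^ j = χ x • clockShift χ (i • u + j • w) := by
  obtain ⟨x, hx⟩ := clockShift_pow χ u i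
  obtain ⟨y, hy⟩ := clockShift_pow χ w j
  refine ⟨x + y + (((j • w) ∘ Sum.inl) ⬝ᵥ ((i • u) ∘ Sum.inr)), ?_⟩
  rw [hx, hy, smul_mul_smul_comm, clockShift_mul, smul_smul, AddChar.map_add_eq_mul,
    AddChar.map_add_eq_mul]

theorem clockShift_commute_smul (u : Fin m ⊕ Fin m → ZMod p) (c : ZMod p) :
    Commute (clockShift χ u) (clockShift χ (c • u)) := by
  rw [Commute, SemiconjBy, clockShift_mul, clockShift_mul, add_comm (c • u)]
  congr 2
  change (c • (u ∘ Sum.inl)) ⬝ᵥ (u ∘ Sum.inr) = (u ∘ Sum.inl) ⬝ᵥ (c • (u ∘ Sum.inr))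
  rw [smul_dotProduct, dotProduct_smul]

theorem clockShift_one_commute (u w : Fin m ⊕ Fin m → ZMod p) :
    Commute (clockShift (1 : AddChar (ZMod p) K) u) (clockShift 1 w) := by
  rw [Commute, SemiconjBy, clockShift_mul, clockShift_mul, add_comm w, AddChar.one_apply,
    AddChar.one_apply]

end ClockShift

/-! ### Leading indices -/

namespace SymbolRep

variable {p m : ℕ} {F K A : Type*} [Field F] [Field K] [Algebra F K] [Ring A]
    [Algebra F A] [NeZero p] (R : SymbolRep p m F K A)
    {Γ : Type*} [LinearOrderedCommGroupWithZero Γ] (ν : Valuation K Γ)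

/-- A valuation for which the eigenvalues `g j i` have the leading term `ξ j * χ i` and the
values of the `ξ j` and `η j` are independent modulo `p` over the value group of `F`. -/
structure IsTame (ξ : Fin m → K) (χ : AddChar (ZMod p) K) : Prop where
  lt : ∀ j i, ν (R.g j i - ξ j * χ i) < ν (ξ j)
  indep : ∀ f : F, f ≠ 0 → ∀ n : Fin m ⊕ Fin m → ℤ,
    ν (algebraMap F K f * ∏ k, Sum.elim ξ R.η k ^ n k) = 1 → ∀ k, (p : ℤ) ∣ n k

/-- The leading term of the coordinate of `z` at the basis element with index `u`. -/
noncomputable def term (ξ : Fin m → K) (z : A) (u : Fin m ⊕ Fin m → ZMod p) : K :=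
  algebraMap F K (R.basis.repr z u) * ∏ k, Sum.elim ξ R.η k ^ (u k).val

/-- `u` is the index of the coordinate of `z` with the largest value. -/
def IsLead (ξ : Fin m → K) (z : A) (u : Fin m ⊕ Fin m → ZMod p) : Prop :=
  R.basis.repr z u ≠ 0 ∧ ∀ w, w ≠ u → ν (R.term ξ z w) < ν (R.term ξ z u)

namespace IsTame

variable {R ν} {ξ : Fin m → K} {χ : AddChar (ZMod p) K}

theorem root_ne_zero (h : R.IsTame ν ξ χ) (k : Fin m ⊕ Fin m) : Sum.elim ξ R.η k ≠ 0 := by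
  rcases k with j | j
  · rw [Sum.elim_inl, ← ν.ne_zero_iff]
    exact (lt_of_le_of_lt zero_le (h.lt j 0)).ne'
  · exact R.η_ne_zero j

theorem monomial_ne_zero (h : R.IsTame ν ξ χ) (u : Fin m ⊕ Fin m → ZMod p) :
    ∏ k, Sum.elim ξ R.η k ^ (u k).val ≠ 0 :=
  Finset.prod_ne_zero_iff.2 fun k _ => pow_ne_zero _ (h.root_ne_zero k)

theorem term_ne_zero (h : R.IsTame ν ξ χ) {z : A} {u} (hu : R.basis.repr z u ≠ 0) :
    R.term ξ z u ≠ 0 :=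
  mul_ne_zero ((map_ne_zero _).2 hu) (h.monomial_ne_zero u)

/-- An index is determined by the value of a corresponding monomial. -/
theorem eq_of_map_eq (h : R.IsTame ν ξ χ) {f f' : F} (hf : f ≠ 0) (hf' : f' ≠ 0)
    {n : Fin m ⊕ Fin m → ℕ} {u : Fin m ⊕ Fin m → ZMod p}
    (heq : ν (algebraMap F K f * ∏ k, Sum.elim ξ R.η k ^ n k) =
      ν (algebraMap F K f' * ∏ k, Sum.elim ξ R.η k ^ (u k).val)) :
    u = fun k => (n k : ZMod p) := by
  have hd := h.indep (f / f') (div_ne_zero hf hf') (fun k => (n k : ℤ) - (u k).val) ?_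
  · funext k
    have := (ZMod.intCast_zmod_eq_zero_iff_dvd _ p).2 (hd k)
    push_cast at this
    rw [ZMod.natCast_zmod_val, sub_eq_zero] at this
    exact this.symm
  · have hmon : ∏ k, Sum.elim ξ R.η k ^ ((n k : ℤ) - (u k).val) =
        (∏ k, Sum.elim ξ R.η k ^ n k) / ∏ k, Sum.elim ξ R.η k ^ (u k).val := by
      rw [← Finset.prod_div_distrib]
      refine Finset.prod_congr rfl fun k _ => ?_
      rw [zpow_sub₀ (h.root_ne_zero k), zpow_natCast, zpow_natCast]
    rw [hmon, map_div₀, div_mul_div_comm, map_div₀, heq]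
    exact div_self (ν.ne_zero_iff.2 (mul_ne_zero ((map_ne_zero _).2 hf') (h.monomial_ne_zero u)))

/-- Terms at distinct indices with nonzero coordinates never have equal values, so the maximum is
attained once. -/
theorem exists_isLead (h : R.IsTame ν ξ χ) {z : A} (hz : z ≠ 0) : ∃ u, R.IsLead ν ξ z u := by
  obtain ⟨u, -, hu⟩ := Finset.exists_max_image Finset.univ (fun u => ν (R.term ξ z u))
    Finset.univ_nonempty
  have hne : ∃ w, R.basis.repr z w ≠ 0 := by
    by_contra! hcon
    exact hz (R.basis.repr.map_eq_zero_iff.1 (Finsupp.ext hcon))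
  obtain ⟨w₀, hw₀⟩ := hne
  have hu0 : R.basis.repr z u ≠ 0 := by
    intro h0
    have := hu w₀ (Finset.mem_univ _)
    simp only [term, h0, map_zero, zero_mul] at this
    exact (ν.ne_zero_iff.2 (h.term_ne_zero hw₀)) (le_antisymm this zero_le)
  refine ⟨u, hu0, fun w hw => lt_of_le_of_ne (hu w (Finset.mem_univ _)) fun heq => hw ?_⟩
  have hw0 : R.basis.repr z w ≠ 0 := by
    intro h0
    simp only [term, h0, map_zero, zero_mul] at heq
    exact (ν.ne_zero_iff.2 (h.term_ne_zero hu0)) heq.symm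
  have := h.eq_of_map_eq hw0 hu0 heq
  rw [this]
  funext k
  simp

/-- Only the eigenvalues `g j i` are approximated, by `ξ j * χ i`; the shifts are exact. -/
theorem toHom_gen_hasLead (h : R.IsTame ν ξ χ) (u : Fin m ⊕ Fin m → ZMod p) :
    (R.toHom (R.gen u)).HasLead ν ((∏ k, Sum.elim ξ R.η k ^ (u k).val) • clockShift χ u)
      (ν (∏ k, Sum.elim ξ R.η k ^ (u k).val)) where
  le i k := by
    rw [Matrix.smul_apply, clockShift_apply, smul_eq_mul, map_mul]
    split_ifs
    · rw [ν.map_addChar, mul_one]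
    · simp
  lt i k := by
    have hpos : 0 < ν (∏ k, Sum.elim ξ R.η k ^ (u k).val) :=
      zero_lt_iff.2 (ν.ne_zero_iff.2 (h.monomial_ne_zero u))
    rw [R.toHom_gen, Matrix.smul_apply, clockShift_apply, smul_eq_mul]
    split_ifs with hk
    · have e : (∏ k, Sum.elim ξ R.η k ^ (u k).val) * χ ((u ∘ Sum.inl) ⬝ᵥ i) =
          ∏ j, ((ξ j * χ (i j)) ^ (u (Sum.inl j)).val * R.η j ^ (u (Sum.inr j)).val) := by
        have hχ : χ ((u ∘ Sum.inl) ⬝ᵥ i) = ∏ j, χ (i j) ^ (u (Sum.inl j)).val := by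
          rw [dotProduct, AddChar.map_sum_eq_prod]
          refine Finset.prod_congr rfl fun j _ => ?_
          rw [← AddChar.map_nsmul_eq_pow, nsmul_eq_mul, ZMod.natCast_zmod_val]
          rfl
        rw [hχ, Fintype.prod_sum_type]
        simp only [Sum.elim_inl, Sum.elim_inr, mul_pow, Finset.prod_mul_distrib]
        ring
      have e2 : ν (∏ k, Sum.elim ξ R.η k ^ (u k).val) =
          ν ((∏ k, Sum.elim ξ R.η k ^ (u k).val) * χ ((u ∘ Sum.inl) ⬝ᵥ i)) := by
        rw [map_mul, ν.map_addChar, mul_one]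
      rw [e2, e]
      refine ν.prod_sub_prod_lt _ fun j _ => ν.mul_sub_mul_lt (ν.pow_sub_pow_lt ?_ _) ?_
      · rw [map_mul, ν.map_addChar, mul_one]
        exact h.lt j (i j)
      · rw [sub_self, map_zero]
        exact zero_lt_iff.2 (ν.ne_zero_iff.2 (pow_ne_zero _ (R.η_ne_zero j)))
    · simpa using hpos

theorem toHom_hasLead (h : R.IsTame ν ξ χ) {z : A} {u} (hu : R.IsLead ν ξ z u) :
    (R.toHom z).HasLead ν (R.term ξ z u • clockShift χ u) (ν (R.term ξ z u)) where
  le i k := by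
    rw [Matrix.smul_apply, clockShift_apply, smul_eq_mul, map_mul]
    split_ifs
    · rw [ν.map_addChar, mul_one]
    · simp
  lt i k := by
    have hpos : 0 < ν (R.term ξ z u) := zero_lt_iff.2 (ν.ne_zero_iff.2 (h.term_ne_zero hu.1))
    have hz : R.toHom z i k =
        ∑ w, algebraMap F K (R.basis.repr z w) * R.toHom (R.gen w) i k := by
      conv_lhs => rw [← R.basis.sum_repr z, map_sum]
      rw [Matrix.sum_apply]
      refine Finset.sum_congr rfl fun w _ => ?_
      rw [map_smul, Matrix.smul_apply, Algebra.smul_def, R.basis_apply]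
    rw [hz, ← Finset.add_sum_erase _ _ (Finset.mem_univ u), add_sub_right_comm]
    refine ν.map_add_lt ?_ (ν.map_sum_lt' hpos fun w hw => ?_)
    · rw [Matrix.smul_apply, term, smul_eq_mul, mul_assoc, ← mul_sub, map_mul, map_mul]
      refine mul_lt_mul_of_pos_left ((h.toHom_gen_hasLead u).lt i k) ?_
      exact zero_lt_iff.2 (ν.ne_zero_iff.2 ((map_ne_zero _).2 hu.1))
    · refine lt_of_le_of_lt ?_ (hu.2 w (Finset.ne_of_mem_erase hw))
      rw [map_mul, term, map_mul]
      exact mul_le_mul_right ((h.toHom_gen_hasLead w).le_left i k) _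

/-- When the leading matrices commute, the mixed product of the leading parts is a binomial
coefficient times a monomial matrix, so nothing cancels. The value of the result then determines its
leading index. -/
theorem repr_mixedProduct_ne_zero (h : R.IsTame ν ξ χ) {z w : A} {u s} (hz : R.IsLead ν ξ z u)
    (hw : R.IsLead ν ξ w s) (hc : Commute (clockShift χ u) (clockShift χ s)) {i j : ℕ}
    (hb : ν (((i + j).choose j : ℕ) : K) = 1) :
    R.basis.repr (mixedProduct z w i j) (i • u + j • s) ≠ 0 := by
  have hl := (h.toHom_hasLead hz).mixedProduct (h.toHom_hasLead hw) i j
  rw [← map_mixedProduct, mixedProduct_of_commute ((hc.smul_left _).smul_right _), smul_pow,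
    smul_pow, smul_mul_smul_comm] at hl
  obtain ⟨x, hx⟩ := clockShift_pow_mul_pow χ u s i j
  rw [hx, ← map_pow, ← map_pow, ← map_mul] at hl
  set γ := R.term ξ z u ^ i * R.term ξ w s ^ j with hγ
  have hγ0 : γ ≠ 0 :=
    mul_ne_zero (pow_ne_zero _ (h.term_ne_zero hz.1)) (pow_ne_zero _ (h.term_ne_zero hw.1))
  -- The binomial coefficient and the root of unity have value `1`, so this entry attains the bound
  -- `ν γ`.
  have hν : ν (R.toHom (mixedProduct z w i j) 0 ((i • u + j • s) ∘ Sum.inr)) = ν γ := by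
    have hlt := hl.lt 0 ((i • u + j • s) ∘ Sum.inr)
    have hval : ν ((((i + j).choose j) • γ • χ x • clockShift χ (i • u + j • s)) 0
        ((i • u + j • s) ∘ Sum.inr)) = ν γ := by
      simp only [Matrix.smul_apply, clockShift_apply, zero_add, if_true, nsmul_eq_mul,
        smul_eq_mul, map_mul, ν.map_addChar, mul_one, hb, one_mul]
    rw [← hval] at hlt ⊢
    exact ν.map_eq_of_sub_lt hlt
  have hne : mixedProduct z w i j ≠ 0 := by
    intro h0
    rw [h0, map_zero, Matrix.zero_apply, map_zero] at hν
    exact ν.ne_zero_iff.2 hγ0 hν.symm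
  obtain ⟨t, ht⟩ := h.exists_isLead hne
  have hl' := h.toHom_hasLead ht
  -- The value of the leading term at `t` is the largest value of a matrix entry, and so is `ν γ`.
  have h1 : ν γ ≤ ν (R.term ξ (mixedProduct z w i j) t) := hν ▸ hl'.le_left _ _
  have h2 : ν (R.term ξ (mixedProduct z w i j) t) ≤ ν γ := by
    have hlt := hl'.lt 0 (t ∘ Sum.inr)
    have hval : ν ((R.term ξ (mixedProduct z w i j) t • clockShift χ t) 0 (t ∘ Sum.inr)) =
        ν (R.term ξ (mixedProduct z w i j) t) := by
      simp only [Matrix.smul_apply, clockShift_apply, zero_add, if_true, smul_eq_mul, map_mul,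
        ν.map_addChar, mul_one]
    rw [← hval] at hlt ⊢
    rw [← ν.map_eq_of_sub_lt hlt]
    exact hl.le_left _ _
  have heq := le_antisymm h1 h2
  have ht' : t = i • u + j • s := by
    have hγ' : γ = algebraMap F K (R.basis.repr z u ^ i * R.basis.repr w s ^ j) *
        ∏ k, Sum.elim ξ R.η k ^ (i * (u k).val + j * (s k).val) := by
      simp only [hγ, term, mul_pow, map_mul, map_pow, pow_add, Finset.prod_mul_distrib,
        pow_mul', Finset.prod_pow]
      ring
    rw [hγ'] at heq
    rw [h.eq_of_map_eq (mul_ne_zero (pow_ne_zero _ hz.1) (pow_ne_zero _ hw.1)) ht.1 heq]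
    funext k
    simp
  exact ht' ▸ ht.1

end IsTame

end SymbolRep

/-! ### Counting lines -/

/-- A subset `S` of `(ℤ/p)ⁿ` such that no `p - 1` elements of `S`, taken from at most two elements
on a line through `-t`, sum to `t`, has at most `(pⁿ - 1) / (p - 1)` elements. -/
theorem card_le_of_nsmul_add_nsmul_ne {p : ℕ} [Fact p.Prime] {ι : Type*} [Fintype ι]
    (S : Finset (ι → ZMod p)) (t : ι → ZMod p)
    (hS : ∀ s ∈ S, ∀ s' ∈ S, ∀ c : ZMod p, s' + t = c • (s + t) → ∀ i j : ℕ, i + j = p - 1 →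
      i • s + j • s' ≠ t) :
    S.card ≤ (p ^ Fintype.card ι - 1) / (p - 1) := by
  classical
  have hp : p.Prime := Fact.out
  have h2 := hp.two_le
  have hcast : ((p - 1 : ℕ) : ZMod p) = -1 := by
    rw [Nat.cast_sub hp.one_le]
    simp
  have h0 : ∀ s ∈ S, s + t ≠ 0 := by
    intro s hs hst
    refine hS s hs s hs 1 (one_smul _ _).symm (p - 1) 0 (by omega) ?_
    rw [zero_smul, add_zero, ← Nat.cast_smul_eq_nsmul (ZMod p), hcast, neg_one_smul]
    exact neg_eq_of_add_eq_zero_right hst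
  have h1 : ∀ s ∈ S, ∀ s' ∈ S, ∀ c : ZMod p, s' + t = c • (s + t) → c = 1 := by
    intro s hs s' hs' c hc
    by_contra hne
    have hne' : c - 1 ≠ 0 := sub_ne_zero.2 hne
    -- Solves `i + j c = 0` together with `i + j = -1` in `ℤ/p`.
    set j := ((c - 1)⁻¹ : ZMod p).val with hj
    have hjp : j < p := ZMod.val_lt _
    refine hS s hs s' hs' c hc (p - 1 - j) j (by omega) ?_
    have hd : s' - s = (c - 1) • (s + t) := by
      rw [sub_smul, ← hc, one_smul]
      abel
    have hs'' : s' = s + (c - 1) • (s + t) := by rw [← hd]; abel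
    rw [← Nat.cast_smul_eq_nsmul (ZMod p), ← Nat.cast_smul_eq_nsmul (ZMod p),
      Nat.cast_sub (by omega), hcast, hj, ZMod.natCast_zmod_val, hs'', smul_add, smul_smul,
      inv_mul_cancel₀ hne', one_smul, sub_smul, neg_one_smul]
    abel
  rw [Nat.le_div_iff_mul_le (by omega)]
  -- The multiples `c (s + t)` with `c` a unit sweep out disjoint punctured lines inside the nonzero
  -- vectors.
  have hinj : Set.InjOn (fun x : (ι → ZMod p) × (ZMod p)ˣ => (x.2 : ZMod p) • (x.1 + t))
      (S ×ˢ (Finset.univ : Finset (ZMod p)ˣ) : Finset _) := by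
    rintro ⟨s, c⟩ hx ⟨s', c'⟩ hx' heq
    simp only [Finset.coe_product, Set.mem_prod, Finset.mem_coe] at hx hx' heq
    have hs' : s' + t = ((c'⁻¹ * c : (ZMod p)ˣ) : ZMod p) • (s + t) := by
      rw [Units.val_mul, mul_smul, heq, smul_smul, Units.inv_mul, one_smul]
    have hc := h1 s hx.1 s' hx'.1 _ hs'
    rw [hc, one_smul] at hs'
    have hcc : c = c' := by
      have : c'⁻¹ * c = 1 := Units.ext hc
      rwa [inv_mul_eq_one, eq_comm] at this
    rw [Prod.mk.injEq]
    exact ⟨(add_right_cancel hs').symm, hcc⟩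
  have hcard := Finset.card_le_card_of_injOn (t := Finset.univ.erase (0 : ι → ZMod p)) _
    (fun x hx => by
      have hx1 := (Finset.mem_product.1 hx).1
      exact Finset.mem_erase.2 ⟨smul_ne_zero x.2.ne_zero (h0 _ hx1), Finset.mem_univ _⟩) hinj
  rw [Finset.card_product, Finset.card_erase_of_mem (Finset.mem_univ _), Finset.card_univ,
    Finset.card_univ, ZMod.card_units, Fintype.card_fun, ZMod.card] at hcard
  exact hcard

/-! ### The dimension bound for a tame representation -/

namespace SymbolRep

variable {p m : ℕ} {F K A : Type*} [Field F] [Field K] [Algebra F K] [Ring A]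
    [Algebra F A]

theorem IsTame.rank_le [Fact p.Prime] [Infinite F] {R : SymbolRep p m F K A}
    {Γ : Type*} [LinearOrderedCommGroupWithZero Γ] {ν : Valuation K Γ} {ξ : Fin m → K}
    {χ : AddChar (ZMod p) K} (h : R.IsTame ν ξ χ)
    (hnat : ∀ k : ℕ, 0 < k → k < p → ν (k : K) = 1)
    (t : Fin m ⊕ Fin m → ZMod p) (ht : χ = 1 ∨ t = 0) (V : Submodule F A)
    (hV : ∀ v ∈ V, R.basis.repr (v ^ (p - 1)) t = 0) :
    Module.rank F V ≤ (((p ^ (2 * m) - 1) / (p - 1) : ℕ) : Cardinal) := by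
  classical
  let S : Finset (Fin m ⊕ Fin m → ZMod p) := Finset.univ.filter fun u => ∃ v ∈ V, R.IsLead ν ξ v u
  have hfact : ∀ n : ℕ, n < p → ν ((n.factorial : ℕ) : K) = 1 := by
    intro n
    induction n with
    | zero => simp
    | succ n ih =>
      intro hn
      rw [Nat.factorial_succ, Nat.cast_mul, map_mul, ih (by omega), hnat _ (by omega) hn, one_mul]
  -- All factorials below `p !` have value `1`, hence so do these binomial coefficients.
  have hchoose : ∀ i j : ℕ, i + j = p - 1 → ν (((i + j).choose j : ℕ) : K) = 1 := by
    intro i j hij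
    have hp := (Fact.out : p.Prime).two_le
    have e := Nat.add_choose_mul_factorial_mul_factorial i j
    have e' := congrArg (fun n : ℕ => ν (n : K)) e
    simp only [Nat.cast_mul, map_mul, hfact i (by omega), hfact j (by omega),
      hfact (i + j) (by omega), mul_one] at e'
    exact e'
  have hcard : S.card ≤ (p ^ (2 * m) - 1) / (p - 1) := by
    have := card_le_of_nsmul_add_nsmul_ne S t ?_
    · simpa [two_mul] using this
    intro s hs s' hs' c hc i j hij heq
    obtain ⟨v, hv, hvs⟩ := (Finset.mem_filter.1 hs).2
    obtain ⟨w, hw, hws⟩ := (Finset.mem_filter.1 hs').2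
    have hcomm : Commute (clockShift χ s) (clockShift χ s') := by
      rcases ht with rfl | rfl
      · exact clockShift_one_commute s s'
      · rw [add_zero, add_zero] at hc
        rw [hc]
        exact clockShift_commute_smul χ s c
    have h1 := h.repr_mixedProduct_ne_zero hvs hws hcomm (hchoose i j hij)
    rw [heq] at h1
    exact h1 (map_mixedProduct_eq_zero (R.basis.coord t) v w (p - 1)
      (fun c => hV _ (V.add_mem hv (V.smul_mem c hw))) hij)
  -- A nonzero `v ∈ V` has a nonzero coordinate at its leading index, which lies in `S`.
  let f : V →ₗ[F] (S → F) := LinearMap.pi fun s => (R.basis.coord s).comp V.subtype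
  have hf : Function.Injective f := by
    rw [← LinearMap.ker_eq_bot, LinearMap.ker_eq_bot']
    intro v hv
    by_contra hne
    obtain ⟨u, hu⟩ := h.exists_isLead (z := (v : A)) (by simpa using hne)
    have hS : u ∈ S := Finset.mem_filter.2 ⟨Finset.mem_univ _, v, v.2, hu⟩
    exact hu.1 (congrFun hv ⟨u, hS⟩)
  have := LinearMap.lift_rank_le_of_injective f hf
  rw [rank_fun', Cardinal.lift_natCast, Cardinal.lift_le_nat_iff, Fintype.card_coe] at this
  exact this.trans (by exact_mod_cast hcard)

end SymbolRep

/-! ### Representations of tensor products of symbol algebras -/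

section Span

variable {F B : Type*} [Field F] [Ring B] [Algebra F B]

/-- `ε = 0` is the relation of the symbol algebra, `ε = 1` the Artin–Schreier relation. -/
theorem pow_mul_pow_mem_span {p : ℕ} [NeZero p] (hp : 2 ≤ p) {x y : B} {α β ε : F}
    (hx : x ^ p = algebraMap F B α + ε • x) (hy : y ^ p = algebraMap F B β) (n k : ℕ) :
    x ^ n * y ^ k ∈
      Submodule.span F (Set.range fun q : ZMod p × ZMod p => x ^ q.1.val * y ^ q.2.val) := by
  have hy' : y ^ k = β ^ (k / p) • y ^ (k % p) := by
    conv_lhs => rw [← Nat.div_add_mod k p]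
    rw [pow_add, pow_mul, hy, ← map_pow, Algebra.smul_def]
  rw [hy', mul_smul_comm]
  refine Submodule.smul_mem _ _ ?_
  induction n using Nat.strong_induction_on with
  | _ n ih =>
    by_cases hn : n < p
    · refine Submodule.subset_span ⟨((n : ZMod p), ((k % p : ℕ) : ZMod p)), ?_⟩
      simp only [ZMod.val_cast_of_lt hn, ZMod.val_cast_of_lt (Nat.mod_lt k (NeZero.pos p))]
    · have e : x ^ n = α • x ^ (n - p) + ε • x ^ (n - p + 1) := by
        conv_lhs => rw [← Nat.sub_add_cancel (not_lt.1 hn)]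
        rw [pow_add, hx, mul_add, ← Algebra.commutes, ← Algebra.smul_def, mul_smul_comm, pow_succ]
      rw [e, add_mul, smul_mul_assoc, smul_mul_assoc]
      exact Submodule.add_mem _ (Submodule.smul_mem _ _ (ih _ (by omega)))
        (Submodule.smul_mem _ _ (ih _ (by omega)))

/-- The span of all `x ^ n * y ^ k` contains `1` and is stable under left multiplication by the
generators. The commutation rule covers both kinds of algebra: `(ρ, c)` is `(ρ, 0)` or `(1, 1)`. -/
theorem span_pow_mul_pow_eq_top {p : ℕ} [NeZero p] (hp : 2 ≤ p) {x y : B} {α β ε ρ c : F}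
    (hgen : Algebra.adjoin F {x, y} = ⊤)
    (hx : x ^ p = algebraMap F B α + ε • x) (hy : y ^ p = algebraMap F B β)
    (hyx : y * x = (ρ • x + algebraMap F B c) * y) :
    Submodule.span F (Set.range fun q : ZMod p × ZMod p => x ^ q.1.val * y ^ q.2.val) = ⊤ := by
  let S := Submodule.span F (Set.range fun q : ℕ × ℕ => x ^ q.1 * y ^ q.2)
  have hmem : ∀ n k, x ^ n * y ^ k ∈ S := fun n k => Submodule.subset_span ⟨(n, k), rfl⟩
  have hstable : ∀ b : B, (∀ n k, b * (x ^ n * y ^ k) ∈ S) → ∀ s ∈ S, b * s ∈ S := by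
    intro b hb s hs
    induction hs using Submodule.span_induction with
    | mem s hs =>
      obtain ⟨q, rfl⟩ := hs
      exact hb _ _
    | zero => simp
    | add s t _ _ hs ht => rw [mul_add]; exact S.add_mem hs ht
    | smul a s _ hs => rw [mul_smul_comm]; exact S.smul_mem a hs
  have hyxn : ∀ n, y * x ^ n = (ρ • x + algebraMap F B c) ^ n * y := by
    intro n
    induction n with
    | zero => simp
    | succ n ih => rw [pow_succ, ← mul_assoc, ih, mul_assoc, hyx, ← mul_assoc, ← pow_succ]
  have hall : ∀ b : B, ∀ s ∈ S, b * s ∈ S := by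
    intro b
    have hb : b ∈ Algebra.adjoin F {x, y} := hgen ▸ Algebra.mem_top
    induction hb using Algebra.adjoin_induction with
    | mem z hz =>
      rcases hz with rfl | rfl
      · refine hstable _ fun n k => ?_
        rw [← mul_assoc, ← pow_succ']
        exact hmem _ _
      · refine hstable _ fun n k => ?_
        rw [← mul_assoc, hyxn, mul_assoc, ← pow_succ']
        have e : (ρ • x + algebraMap F B c) ^ n =
            Polynomial.aeval x ((ρ • Polynomial.X + Polynomial.C c) ^ n) := by
          simp
        rw [e, Polynomial.aeval_eq_sum_range, Finset.sum_mul]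
        refine Submodule.sum_mem _ fun i _ => ?_
        rw [smul_mul_assoc]
        exact S.smul_mem _ (hmem _ _)
    | algebraMap r =>
      intro s hs
      rw [← Algebra.smul_def]
      exact S.smul_mem r hs
    | add a b _ _ ha hb =>
      intro s hs
      rw [add_mul]
      exact S.add_mem (ha s hs) (hb s hs)
    | mul a b _ _ ha hb =>
      intro s hs
      rw [mul_assoc]
      exact ha _ (hb s hs)
  rw [eq_top_iff]
  intro b _
  have h1 : b * 1 ∈ S := hall b 1 (by simpa using hmem 0 0)
  rw [mul_one] at h1
  refine (Submodule.span_le.2 ?_ : S ≤ _) h1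
  rintro _ ⟨q, rfl⟩
  exact pow_mul_pow_mem_span hp hx hy _ _

end Span

section Kronecker

variable {F K ι : Type*} [Field F] [Field K] [Algebra F K] [Fintype ι]
  {n : Type*} [Fintype n] [DecidableEq n] {B : ι → Type*} [∀ j, Ring (B j)] [∀ j, Algebra F (B j)]

/-- The Kronecker product of a family of matrix representations, as a multilinear map. -/
def kroneckerMultilinear (ψ : ∀ j, B j →ₐ[F] Matrix n n K) :
    MultilinearMap F B (Matrix (ι → n) (ι → n) K) :=
  let E (i k : ι → n) : MultilinearMap F B K := (MultilinearMap.mkPiAlgebra F ι K).compLinearMap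
    fun j => (Matrix.entryLinearMap F K (i j) (k j)).comp (ψ j).toLinearMap
  { toFun := fun b => Matrix.of fun i k => ∏ j, ψ j (b j) (i j) (k j)
    map_update_add' := fun b j s t => Matrix.ext fun i k => (E i k).map_update_add b j s t
    map_update_smul' := fun b j s t => Matrix.ext fun i k => (E i k).map_update_smul b j s t }

theorem kroneckerMultilinear_apply (ψ : ∀ j, B j →ₐ[F] Matrix n n K) (b : ∀ j, B j)
    (i k : ι → n) : kroneckerMultilinear ψ b i k = ∏ j, ψ j (b j) (i j) (k j) := rfl

variable [DecidableEq ι]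

/-- The representation of a tensor product given by Kronecker products. -/
noncomputable def kroneckerHom (ψ : ∀ j, B j →ₐ[F] Matrix n n K) :
    (⨂[F] j, B j) →ₐ[F] Matrix (ι → n) (ι → n) K :=
  PiTensorProduct.liftAlgHom (kroneckerMultilinear ψ)
    (by
      ext i k
      simp only [kroneckerMultilinear_apply, Pi.one_apply, map_one, Matrix.one_apply]
      rw [Finset.prod_ite_zero]
      simp [funext_iff])
    (by
      intro a b
      ext i k
      simp only [kroneckerMultilinear_apply, Pi.mul_apply, map_mul, Matrix.mul_apply,
        ← Finset.prod_mul_distrib]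
      rw [Finset.prod_univ_sum, Fintype.piFinset_univ])

theorem kroneckerHom_tprod (ψ : ∀ j, B j →ₐ[F] Matrix n n K) (b : ∀ j, B j) (i k : ι → n) :
    kroneckerHom ψ (PiTensorProduct.tprod F b) i k = ∏ j, ψ j (b j) (i j) (k j) := by
  rw [← kroneckerMultilinear_apply, kroneckerHom, PiTensorProduct.liftAlgHom_apply]
  rw [PiTensorProduct.lift.tprod]

theorem PiTensorProduct.span_tprod_eq_top_of_span {κ : Type*} [Fintype κ] {w : ∀ j, κ → B j}
    (hw : ∀ j, Submodule.span F (Set.range (w j)) = ⊤) :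
    Submodule.span F (Set.range fun r : ι → κ => PiTensorProduct.tprod F fun j => w j (r j)) =
      ⊤ := by
  rw [eq_top_iff, ← PiTensorProduct.span_tprod_eq_top, Submodule.span_le]
  rintro _ ⟨b, rfl⟩
  have : ∀ j, ∃ c : κ → F, ∑ q, c q • w j q = b j := fun j =>
    (Submodule.mem_span_range_iff_exists_fun F).1 (hw j ▸ Submodule.mem_top)
  choose c hc using this
  obtain rfl : (fun j => ∑ q, c j q • w j q) = b := funext hc
  rw [SetLike.mem_coe, MultilinearMap.map_sum]
  refine Submodule.sum_mem _ fun r _ => ?_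
  rw [MultilinearMap.map_smul_univ]
  exact Submodule.smul_mem _ _ (Submodule.subset_span ⟨r, rfl⟩)

end Kronecker

section Shift

variable (p : ℕ) [NeZero p] (K : Type*) [Field K]

/-- The matrix of the cyclic shift. -/
def shiftMatrix : Matrix (ZMod p) (ZMod p) K := Matrix.of fun i k => if k = i + 1 then 1 else 0

theorem shiftMatrix_pow_apply (n : ℕ) (i k : ZMod p) :
    (shiftMatrix p K ^ n) i k = if k = i + n then 1 else 0 := by
  induction n generalizing k with
  | zero => simp [Matrix.one_apply, eq_comm]
  | succ n ih =>
    rw [pow_succ, Matrix.mul_apply]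
    simp only [ih]
    rw [Finset.sum_eq_single (i + n)]
    · simp [shiftMatrix, add_assoc]
    · intro l _ hl
      rw [if_neg hl, zero_mul]
    · simp

theorem shiftMatrix_pow_self : shiftMatrix p K ^ p = 1 := by
  ext i k
  simp [shiftMatrix_pow_apply, Matrix.one_apply, eq_comm]

variable {p K}

theorem shiftMatrix_mul_diagonal (d : ZMod p → K) :
    shiftMatrix p K * Matrix.diagonal d =
      Matrix.diagonal (fun i => d (i + 1)) * shiftMatrix p K := by
  ext i k
  rw [Matrix.mul_diagonal, Matrix.diagonal_mul]
  simp only [shiftMatrix, Matrix.of_apply]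
  split_ifs with h
  · rw [h, one_mul, mul_one]
  · simp

theorem diagonal_pow_mul_shiftMatrix_pow_apply (d : ZMod p → K) (η : K) (a b : ℕ) (i k : ZMod p) :
    (Matrix.diagonal d ^ a * (η • shiftMatrix p K) ^ b) i k =
      if k = i + b then d i ^ a * η ^ b else 0 := by
  rw [Matrix.diagonal_pow, Matrix.diagonal_mul, smul_pow, Matrix.smul_apply, shiftMatrix_pow_apply]
  simp

end Shift

/-- The representation of a tensor product of algebras that are generated by a clock and a shift
matrix. -/
noncomputable def SymbolRep.ofPi {p m : ℕ} [NeZero p] {F K : Type*} [Field F] [Field K]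
    [Algebra F K] {B : Fin m → Type*} [∀ j, Ring (B j)] [∀ j, Algebra F (B j)]
    (ψ : ∀ j, B j →ₐ[F] Matrix (ZMod p) (ZMod p) K) (x y : ∀ j, B j)
    (hspan : ∀ j, Submodule.span F
      (Set.range fun q : ZMod p × ZMod p => x j ^ q.1.val * y j ^ q.2.val) = ⊤)
    (g : Fin m → ZMod p → K) (hg : ∀ j, Function.Injective (g j)) (η : Fin m → K)
    (hη : ∀ j, η j ≠ 0) (hx : ∀ j, ψ j (x j) = Matrix.diagonal (g j))
    (hy : ∀ j, ψ j (y j) = η j • shiftMatrix p K) :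
    SymbolRep p m F K (⨂[F] j, B j) where
  toHom := kroneckerHom ψ
  gen u := PiTensorProduct.tprod F fun j => x j ^ (u (Sum.inl j)).val * y j ^ (u (Sum.inr j)).val
  span_gen := by
    rw [← PiTensorProduct.span_tprod_eq_top_of_span hspan]
    congr 1
    ext z
    constructor
    · rintro ⟨u, rfl⟩
      exact ⟨fun j => (u (Sum.inl j), u (Sum.inr j)), rfl⟩
    · rintro ⟨r, rfl⟩
      exact ⟨Sum.elim (fun j => (r j).1) fun j => (r j).2, rfl⟩
  g := g
  g_injective := hg
  η := η
  η_ne_zero := hη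
  toHom_gen u i k := by
    rw [kroneckerHom_tprod]
    simp only [map_mul, map_pow, hx, hy, diagonal_pow_mul_shiftMatrix_pow_apply,
      ZMod.natCast_zmod_val]
    rw [Finset.prod_ite_zero]
    simp [funext_iff]

theorem RingQuot.adjoin_mkAlgHom_ι_eq_top {F : Type*} [Field F]
    (r : FreeAlgebra F (Fin 2) → FreeAlgebra F (Fin 2) → Prop) :
    Algebra.adjoin F {RingQuot.mkAlgHom F r (FreeAlgebra.ι F 0),
      RingQuot.mkAlgHom F r (FreeAlgebra.ι F 1)} = ⊤ := by
  have h := congrArg (Subalgebra.map (RingQuot.mkAlgHom F r)) (FreeAlgebra.adjoin_range_ι F (Fin 2))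
  rw [AlgHom.map_adjoin, Algebra.map_top, (AlgHom.range_eq_top _).2
    (RingQuot.mkAlgHom_surjective F r), ← Set.range_comp] at h
  rw [← h]
  congr 1
  ext z
  simp [Set.mem_range, Fin.exists_fin_two, eq_comm]

section Hom

variable {F : Type u} {K : Type*} [Field F] [Field K] [Algebra F K] {p : ℕ} [NeZero p]

theorem SymbolAlgebra.exists_hom (hp : 2 ≤ p) {ρ α β : F} {ξ η : K}
    (hξ : ξ ^ p = algebraMap F K α) (hη : η ^ p = algebraMap F K β) (χ : AddChar (ZMod p) K)
    (hχ : χ 1 = algebraMap F K ρ) :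
    ∃ (ψ : SymbolAlgebra p ρ α β →ₐ[F] Matrix (ZMod p) (ZMod p) K) (x y : SymbolAlgebra p ρ α β),
      ψ x = Matrix.diagonal (fun i => ξ * χ i) ∧ ψ y = η • shiftMatrix p K ∧
      Submodule.span F (Set.range fun q : ZMod p × ZMod p => x ^ q.1.val * y ^ q.2.val) = ⊤ := by
  let f : FreeAlgebra F (Fin 2) →ₐ[F] Matrix (ZMod p) (ZMod p) K :=
    FreeAlgebra.lift F ![Matrix.diagonal (fun i => ξ * χ i), η • shiftMatrix p K]
  have f0 : f (FreeAlgebra.ι F 0) = Matrix.diagonal (fun i => ξ * χ i) := by simp [f]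
  have f1 : f (FreeAlgebra.ι F 1) = η • shiftMatrix p K := by simp [f]
  have hf : ∀ ⦃a b⦄, SymbolRel p ρ α β a b → f a = f b := by
    intro a b hab
    cases hab with
    | x_pow =>
      rw [map_pow, f0, AlgHom.commutes, Matrix.diagonal_pow, Matrix.algebraMap_eq_diagonal]
      congr 1
      funext i
      simp [mul_pow, hξ, AddChar.pow_eq_one]
    | y_pow =>
      rw [map_pow, f1, AlgHom.commutes, smul_pow, shiftMatrix_pow_self, hη,
        Algebra.algebraMap_eq_smul_one, smul_assoc, one_smul, Algebra.algebraMap_eq_smul_one]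
    | comm =>
      rw [map_mul, map_smul, map_mul, f0, f1, smul_mul_assoc, shiftMatrix_mul_diagonal,
        mul_smul_comm, smul_comm ρ η, ← smul_mul_assoc ρ, ← Matrix.diagonal_smul]
      congr 3
      funext i
      rw [AddChar.map_add_eq_mul, hχ, Pi.smul_apply, Algebra.smul_def]
      ring
  refine ⟨RingQuot.liftAlgHom F ⟨f, hf⟩, RingQuot.mkAlgHom F _ (FreeAlgebra.ι F 0),
    RingQuot.mkAlgHom F _ (FreeAlgebra.ι F 1), ?_, ?_, ?_⟩
  · rw [RingQuot.liftAlgHom_mkAlgHom_apply, f0]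
  · rw [RingQuot.liftAlgHom_mkAlgHom_apply, f1]
  · refine span_pow_mul_pow_eq_top (α := α) (β := β) (ε := 0) (ρ := ρ) (c := 0) hp
      (RingQuot.adjoin_mkAlgHom_ι_eq_top _) ?_ ?_ ?_
    · rw [← map_pow, RingQuot.mkAlgHom_rel F (SymbolRel.x_pow (p := p) (ρ := ρ) (β := β)),
        AlgHom.commutes, zero_smul, add_zero]
    · rw [← map_pow, RingQuot.mkAlgHom_rel F (SymbolRel.y_pow (p := p) (ρ := ρ) (α := α)),
        AlgHom.commutes]
    · rw [← map_mul, RingQuot.mkAlgHom_rel F (SymbolRel.comm (p := p) (α := α) (β := β)), map_smul,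
        map_mul, map_zero, add_zero, smul_mul_assoc]

/-- The roots of `X ^ p - X - α` are the translates of `ξ` by the prime field, permuted cyclically
by the shift. -/
theorem SymbolAlgebraCharP.exists_hom [Fact p.Prime] [CharP K p] {α β : F} {ξ η : K}
    (hξ : ξ ^ p - ξ = algebraMap F K α) (hη : η ^ p = algebraMap F K β) :
    ∃ (ψ : SymbolAlgebraCharP p α β →ₐ[F] Matrix (ZMod p) (ZMod p) K)
      (x y : SymbolAlgebraCharP p α β),
      ψ x = Matrix.diagonal (fun i => ξ + ZMod.castHom dvd_rfl K i) ∧ ψ y = η • shiftMatrix p K ∧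
      Submodule.span F (Set.range fun q : ZMod p × ZMod p => x ^ q.1.val * y ^ q.2.val) = ⊤ := by
  let f : FreeAlgebra F (Fin 2) →ₐ[F] Matrix (ZMod p) (ZMod p) K := FreeAlgebra.lift F
    ![Matrix.diagonal (fun i => ξ + ZMod.castHom dvd_rfl K i), η • shiftMatrix p K]
  have f0 : f (FreeAlgebra.ι F 0) = Matrix.diagonal (fun i => ξ + ZMod.castHom dvd_rfl K i) := by
    simp [f]
  have f1 : f (FreeAlgebra.ι F 1) = η • shiftMatrix p K := by simp [f]
  have hf : ∀ ⦃a b⦄, SymbolRelCharP p α β a b → f a = f b := by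
    intro a b hab
    cases hab with
    | x_pow =>
      rw [map_sub, map_pow, f0, AlgHom.commutes, Matrix.diagonal_pow, Matrix.diagonal_sub,
        Matrix.algebraMap_eq_diagonal]
      congr 1
      funext i
      rw [Pi.pow_apply, add_pow_char, ← map_pow, ZMod.pow_card, add_sub_add_right_eq_sub, hξ]
      rfl
    | y_pow =>
      rw [map_pow, f1, AlgHom.commutes, smul_pow, shiftMatrix_pow_self, hη,
        Algebra.algebraMap_eq_smul_one, smul_assoc, one_smul, Algebra.algebraMap_eq_smul_one]
    | comm =>
      rw [map_mul, map_mul, map_add, map_one, f0, f1, smul_mul_assoc, shiftMatrix_mul_diagonal,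
        mul_smul_comm, ← Matrix.diagonal_one, Matrix.diagonal_add]
      congr 3
      funext i
      rw [map_add, map_one, add_assoc]
  refine ⟨RingQuot.liftAlgHom F ⟨f, hf⟩, RingQuot.mkAlgHom F _ (FreeAlgebra.ι F 0),
    RingQuot.mkAlgHom F _ (FreeAlgebra.ι F 1), ?_, ?_, ?_⟩
  · rw [RingQuot.liftAlgHom_mkAlgHom_apply, f0]
  · rw [RingQuot.liftAlgHom_mkAlgHom_apply, f1]
  · refine span_pow_mul_pow_eq_top (α := α) (β := β) (ε := 1) (ρ := 1) (c := 1)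
      (Fact.out : p.Prime).two_le (RingQuot.adjoin_mkAlgHom_ι_eq_top _) ?_ ?_ ?_
    · have := RingQuot.mkAlgHom_rel F (SymbolRelCharP.x_pow (p := p) (α := α) (β := β))
      rw [map_sub, map_pow, AlgHom.commutes, sub_eq_iff_eq_add] at this
      rw [this, one_smul]
    · rw [← map_pow, RingQuot.mkAlgHom_rel F (SymbolRelCharP.y_pow (p := p) (α := α)),
        AlgHom.commutes]
    · rw [← map_mul, RingQuot.mkAlgHom_rel F (SymbolRelCharP.comm (p := p) (α := α) (β := β)),
        map_mul, map_add, map_one, map_one, one_smul]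

end Hom

/-! ### Traces of the basis elements -/

namespace SymbolRep

variable {p m : ℕ} {F K A : Type*} [Field F] [Field K] [Algebra F K] [Ring A]
    [Algebra F A] [NeZero p] (R : SymbolRep p m F K A)

/-- A nontrivial shift has zero diagonal; otherwise the trace factors into power sums of the
eigenvalues. -/
theorem trace_toHom_gen (u : Fin m ⊕ Fin m → ZMod p) :
    (R.toHom (R.gen u)).trace =
      if u ∘ Sum.inr = 0 then ∏ j, ∑ i, R.g j i ^ (u (Sum.inl j)).val else 0 := by
  simp only [Matrix.trace, Matrix.diag_apply, R.toHom_gen, left_eq_add]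
  split_ifs with h
  · rw [Fintype.prod_sum]
    refine Finset.sum_congr rfl fun i _ => Finset.prod_congr rfl fun j _ => ?_
    have : u (Sum.inr j) = 0 := congrFun h j
    rw [this, ZMod.val_zero, pow_zero, mul_one]
  · exact Finset.sum_const_zero

theorem trace_toHom {t : Fin m ⊕ Fin m → ZMod p} {θ : F}
    (ht : ∀ u, (R.toHom (R.gen u)).trace = if u = t then algebraMap F K θ else 0) (z : A) :
    (R.toHom z).trace = algebraMap F K (R.basis.repr z t * θ) := by
  conv_lhs => rw [← R.basis.sum_repr z, map_sum, Matrix.trace_sum]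
  rw [Finset.sum_eq_single t]
  · rw [map_smul, Matrix.trace_smul, R.basis_apply, ht, if_pos rfl, Algebra.smul_def, map_mul]
  · intro u _ hu
    rw [map_smul, Matrix.trace_smul, R.basis_apply, ht, if_neg hu, smul_zero]
  · simp

theorem trace_toHom_gen_of_sum {t₀ : ZMod p} {θ : F} (ht : ∀ j (a : ZMod p),
    ∑ i, R.g j i ^ a.val = if a = t₀ then algebraMap F K θ else 0) (u : Fin m ⊕ Fin m → ZMod p) :
    (R.toHom (R.gen u)).trace =
      if u = Sum.elim (fun _ => t₀) 0 then algebraMap F K (θ ^ m) else 0 := by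
  rw [R.trace_toHom_gen]
  simp only [ht]
  rw [Finset.prod_ite_zero, Finset.prod_const, Finset.card_univ, Fintype.card_fin, ← map_pow]
  by_cases hu : u = Sum.elim (fun _ => t₀) 0
  · subst hu
    simp
  · rw [if_neg hu]
    split_ifs with h1 h2
    · refine absurd (funext fun k => ?_) hu
      rcases k with j | j
      · exact h2 j (Finset.mem_univ j)
      · exact congrFun h1 j
    · rfl
    · rfl

end SymbolRep

/-- For `a ≠ 0`, multiplication by `a` permutes `ℤ/p`, and a nontrivial character sums to zero. -/
theorem sum_mul_addChar_pow {K : Type*} [Field K] {p : ℕ} [Fact p.Prime] (ξ : K)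
    {χ : AddChar (ZMod p) K} (hχ : χ ≠ 1) (a : ZMod p) :
    ∑ i, (ξ * χ i) ^ a.val = if a = 0 then (p : K) else 0 := by
  split_ifs with h
  · simp [h]
  · simp only [mul_pow, ← Finset.mul_sum]
    have : ∑ i, χ i ^ a.val = ∑ i, χ i := by
      rw [← Equiv.sum_comp (Equiv.mulLeft₀ a h) χ]
      refine Finset.sum_congr rfl fun i _ => ?_
      rw [← AddChar.map_nsmul_eq_pow, nsmul_eq_mul, ZMod.natCast_zmod_val]
      rfl
    rw [this, AddChar.sum_eq_zero_of_ne_one hχ, mul_zero]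

/-- Among the power sums of `ℤ/p` with exponent at most `p - 1`, only the one of exponent `p - 1` is
nonzero, and it equals `-1`. -/
theorem sum_add_cast_pow {K : Type*} [Field K] {p : ℕ} [Fact p.Prime] [CharP K p] (ξ : K)
    (a : ZMod p) :
    ∑ i, (ξ + ZMod.castHom dvd_rfl K i) ^ a.val = if a = -1 then -1 else 0 := by
  have h2 := (Fact.out : p.Prime).two_le
  have hval : (-1 : ZMod p).val = p - 1 := by
    obtain ⟨q, rfl⟩ : ∃ q, p = q + 1 := ⟨p - 1, by omega⟩
    simp [ZMod.val_neg_one]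
  have hlt := ZMod.val_lt a
  have hsum : ∀ k : ℕ, k < p - 1 → ∑ i : ZMod p, (ZMod.castHom dvd_rfl K i) ^ k = 0 := by
    intro k hk
    have := congrArg (ZMod.castHom dvd_rfl K)
      (FiniteField.sum_pow_lt_card_sub_one (ZMod p) k (by rwa [ZMod.card]))
    rw [map_sum, map_zero] at this
    simpa only [map_pow] using this
  have hsum' : ∑ i : ZMod p, (ZMod.castHom dvd_rfl K i) ^ (p - 1) = -1 := by
    have hpow : ∀ i : ZMod p, (ZMod.castHom dvd_rfl K i) ^ (p - 1) =
        1 - if i = 0 then 1 else 0 := by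
      intro i
      rw [← map_pow]
      split_ifs with hi
      · rw [hi, zero_pow (by omega), map_zero, sub_self]
      · rw [ZMod.pow_card_sub_one_eq_one hi, map_one, sub_zero]
    simp only [hpow]
    simp
  simp only [add_comm ξ, add_pow]
  rw [Finset.sum_comm]
  simp only [← Finset.sum_mul]
  by_cases ha : a = -1
  · rw [if_pos ha, ha, hval, Finset.sum_range_succ, hsum', Finset.sum_eq_zero]
    · simp
    · intro k hk
      rw [hsum k (Finset.mem_range.1 hk)]
      simp
  · rw [if_neg ha]
    have hne : a.val ≠ p - 1 := fun h => ha (ZMod.val_injective p (h.trans hval.symm))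
    refine Finset.sum_eq_zero fun k hk => ?_
    rw [hsum k (by rw [Finset.mem_range] at hk; omega)]
    simp

/-! ### Extension of valuations, and composite valuations on Laurent series -/

/-- A valuation ring of `K` dominates the image of `𝒪`. If `x ∉ 𝒪` but `f x ∈ B`, then `x⁻¹` maps to
a unit of `B`, so by domination it is a unit of `𝒪`, a contradiction. -/
theorem ValuationSubring.exists_extension {F K : Type*} [Field F] [Field K] (f : F →+* K)
    (𝒪 : ValuationSubring F) :
    ∃ B : ValuationSubring K, ∀ x, f x ∈ B ↔ x ∈ 𝒪 := by
  obtain ⟨B, hB, hloc⟩ := IsLocalRing.exists_factor_valuationRing (f.comp 𝒪.subtype)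
  refine ⟨B, fun x => ⟨fun hx => ?_, fun hx => hB ⟨x, hx⟩⟩⟩
  by_contra hx'
  have hinv := (𝒪.mem_or_inv_mem x).resolve_left hx'
  have hx0 : x ≠ 0 := by
    rintro rfl
    exact hx' 𝒪.zero_mem
  have hu : IsUnit (⟨x⁻¹, hinv⟩ : 𝒪) := by
    refine hloc.map_nonunit _ (IsUnit.of_mul_eq_one ⟨f x, hx⟩ (Subtype.ext ?_))
    change f x⁻¹ * f x = 1
    rw [← map_mul, inv_mul_cancel₀ hx0, map_one]
  obtain ⟨⟨y, hy⟩, hxy⟩ := hu.exists_right_inv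
  have h1 : x⁻¹ * y = 1 := congrArg Subtype.val hxy
  have : y = x := by
    rw [inv_mul_eq_one₀ hx0] at h1
    exact h1.symm
  exact hx' (this ▸ hy)

/-- Lets "value `1`" pass between fields whose value groups are unrelated. -/
theorem ValuationSubring.valuation_eq_one_iff_mem {F : Type*} [Field F] (𝒪 : ValuationSubring F)
    {x : F} (hx : x ≠ 0) : 𝒪.valuation x = 1 ↔ x ∈ 𝒪 ∧ x⁻¹ ∈ 𝒪 := by
  rw [← 𝒪.valuation_le_one_iff, ← 𝒪.valuation_le_one_iff, map_inv₀,
    inv_le_one₀ (zero_lt_iff.2 (𝒪.valuation.ne_zero_iff.2 hx)), le_antisymm_iff]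

namespace LaurentSeries

variable {K : Type*} [Field K]

theorem coeff_mem_iff_order (𝒪 : ValuationSubring K) (x : LaurentSeries K) :
    ((∀ n < 0, x.coeff n = 0) ∧ x.coeff 0 ∈ 𝒪) ↔
      (x = 0 ∨ 0 < x.order ∨ x.order = 0 ∧ x.leadingCoeff ∈ 𝒪) := by
  by_cases hx : x = 0
  · simp [hx, 𝒪.zero_mem]
  constructor
  · rintro ⟨h1, h2⟩
    have hne : x.coeff x.order ≠ 0 := by
      rw [← HahnSeries.leadingCoeff_eq]
      exact HahnSeries.leadingCoeff_ne_zero.2 hx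
    have hord : 0 ≤ x.order := by
      by_contra! hlt
      exact hne (h1 _ hlt)
    rcases hord.lt_or_eq with h | h
    · exact Or.inr (Or.inl h)
    · refine Or.inr (Or.inr ⟨h.symm, ?_⟩)
      rwa [HahnSeries.leadingCoeff_eq, ← h]
  · rintro (h | h | ⟨h, h'⟩)
    · exact absurd h hx
    · refine ⟨fun n hn => HahnSeries.coeff_eq_zero_of_lt_order (hn.trans h), ?_⟩
      rw [HahnSeries.coeff_eq_zero_of_lt_order h]
      exact 𝒪.zero_mem
    · refine ⟨fun n hn => HahnSeries.coeff_eq_zero_of_lt_order (by rwa [h]), ?_⟩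
      rwa [HahnSeries.leadingCoeff_eq, h] at h'

theorem order_inv {x : LaurentSeries K} (hx : x ≠ 0) : x⁻¹.order = -x.order := by
  have h := HahnSeries.order_mul hx (inv_ne_zero hx)
  rw [mul_inv_cancel₀ hx, HahnSeries.order_one] at h
  omega

theorem leadingCoeff_inv (x : LaurentSeries K) : x⁻¹.leadingCoeff = x.leadingCoeff⁻¹ := by
  by_cases hx : x = 0
  · simp [hx]
  have h := HahnSeries.leadingCoeff_mul x x⁻¹
  rw [mul_inv_cancel₀ hx, HahnSeries.leadingCoeff_one] at h
  exact eq_inv_of_mul_eq_one_right h.symm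

/-- The composite of the order valuation with the valuation of the residue field given by `𝒪`. -/
def compositeSubring (𝒪 : ValuationSubring K) : ValuationSubring (LaurentSeries K) where
  carrier := {x | (∀ n < 0, x.coeff n = 0) ∧ x.coeff 0 ∈ 𝒪}
  zero_mem' := ⟨fun _ _ => rfl, 𝒪.zero_mem⟩
  one_mem' := (coeff_mem_iff_order 𝒪 1).2 (Or.inr (Or.inr (by simp [𝒪.one_mem])))
  add_mem' := fun {x y} hx hy =>
    ⟨fun n hn => by simp [hx.1 n hn, hy.1 n hn], 𝒪.add_mem _ _ hx.2 hy.2⟩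
  neg_mem' := fun {x} hx => ⟨fun n hn => by simp [hx.1 n hn], 𝒪.neg_mem _ hx.2⟩
  mul_mem' := fun {x y} hx hy => by
    refine (coeff_mem_iff_order 𝒪 _).2 ?_
    by_cases hx0 : x = 0
    · simp [hx0]
    by_cases hy0 : y = 0
    · simp [hy0]
    rw [HahnSeries.order_mul hx0 hy0, HahnSeries.leadingCoeff_mul]
    rcases ((coeff_mem_iff_order 𝒪 x).1 hx).resolve_left hx0 with h | ⟨h, h'⟩ <;>
      rcases ((coeff_mem_iff_order 𝒪 y).1 hy).resolve_left hy0 with k | ⟨k, k'⟩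
    · exact Or.inr (Or.inl (by omega))
    · exact Or.inr (Or.inl (by omega))
    · exact Or.inr (Or.inl (by omega))
    · exact Or.inr (Or.inr ⟨by omega, 𝒪.mul_mem _ _ h' k'⟩)
  mem_or_inv_mem' := fun x => by
    change ((∀ n < 0, x.coeff n = 0) ∧ x.coeff 0 ∈ 𝒪) ∨
      ((∀ n < 0, x⁻¹.coeff n = 0) ∧ x⁻¹.coeff 0 ∈ 𝒪)
    rw [coeff_mem_iff_order, coeff_mem_iff_order]
    by_cases hx : x = 0
    · exact Or.inl (Or.inl hx)
    rw [order_inv hx, leadingCoeff_inv]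
    rcases lt_trichotomy x.order 0 with h | h | h
    · exact Or.inr (Or.inr (Or.inl (by omega)))
    · rcases 𝒪.mem_or_inv_mem x.leadingCoeff with h' | h'
      · exact Or.inl (Or.inr (Or.inr ⟨h, h'⟩))
      · exact Or.inr (Or.inr (Or.inr ⟨by omega, h'⟩))
    · exact Or.inl (Or.inr (Or.inl h))

variable {𝒪 : ValuationSubring K}

theorem mem_compositeSubring_iff {x : LaurentSeries K} : x ∈ compositeSubring 𝒪 ↔
    (x = 0 ∨ 0 < x.order ∨ x.order = 0 ∧ x.leadingCoeff ∈ 𝒪) :=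
  coeff_mem_iff_order 𝒪 x

theorem C_mem_compositeSubring_iff {c : K} : HahnSeries.C c ∈ compositeSubring 𝒪 ↔ c ∈ 𝒪 := by
  by_cases hc : c = 0
  · simp [hc, zero_mem]
  rw [mem_compositeSubring_iff, HahnSeries.order_C, HahnSeries.C_apply,
    HahnSeries.leadingCoeff_of_single]
  simp [hc]

theorem single_notMem_compositeSubring :
    (HahnSeries.single (-1) 1 : LaurentSeries K) ∉ compositeSubring 𝒪 := by
  rw [mem_compositeSubring_iff, HahnSeries.order_single one_ne_zero]
  simp

theorem valuation_compositeSubring_eq_one {x : LaurentSeries K}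
    (h : (compositeSubring 𝒪).valuation x = 1) :
    x.order = 0 ∧ 𝒪.valuation x.leadingCoeff = 1 := by
  have hx : x ≠ 0 := by
    rintro rfl
    simp at h
  rw [ValuationSubring.valuation_eq_one_iff_mem _ hx, mem_compositeSubring_iff,
    mem_compositeSubring_iff, order_inv hx, leadingCoeff_inv] at h
  have h1 := h.1.resolve_left hx
  have h2 := h.2.resolve_left (inv_ne_zero hx)
  rw [ValuationSubring.valuation_eq_one_iff_mem _ (HahnSeries.leadingCoeff_ne_zero.2 hx)]
  rcases h1 with h1 | ⟨h1, h1'⟩ <;> rcases h2 with h2 | ⟨h2, h2'⟩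
  · omega
  · omega
  · omega
  · exact ⟨h1, h1', h2'⟩

/-- Value `1` forces order `0`, that is `n = q * f.order`, and a leading coefficient of value `1`,
which is the same kind of relation one level down. -/
theorem compositeSubring_independent {q : ℕ} {f : LaurentSeries K} (hf : f ≠ 0) {Q : K}
    (hQ : Q ≠ 0) {n : ℤ} (h : (compositeSubring 𝒪).valuation
      (f ^ q * HahnSeries.C Q * HahnSeries.single (-1) 1 ^ n) = 1) :
    (q : ℤ) ∣ n ∧ ∃ f' : K, f' ≠ 0 ∧ 𝒪.valuation (f' ^ q * Q) = 1 := by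
  have hs : (HahnSeries.single (-1) 1 : LaurentSeries K) ^ n = HahnSeries.single (-n) 1 := by
    rw [RatFunc.single_zpow (-n), RatFunc.single_zpow (-1), ← zpow_mul, neg_one_mul]
  have hpow : ∀ k : ℕ, (f ^ k).order = k * f.order ∧ (f ^ k).leadingCoeff = f.leadingCoeff ^ k := by
    intro k
    induction k with
    | zero => simp
    | succ k ih =>
      rw [pow_succ, HahnSeries.order_mul (pow_ne_zero _ hf) hf, HahnSeries.leadingCoeff_mul, ih.1,
        ih.2, pow_succ]
      push_cast
      exact ⟨by ring, rfl⟩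
  have hC : (HahnSeries.C Q : LaurentSeries K) ≠ 0 := HahnSeries.C_ne_zero hQ
  obtain ⟨h1, h2⟩ := valuation_compositeSubring_eq_one h
  rw [hs, HahnSeries.order_mul (mul_ne_zero (pow_ne_zero _ hf) hC)
    (HahnSeries.single_ne_zero one_ne_zero), HahnSeries.order_mul (pow_ne_zero _ hf) hC,
    HahnSeries.order_single one_ne_zero, HahnSeries.order_C, (hpow q).1] at h1
  rw [hs, HahnSeries.leadingCoeff_mul, HahnSeries.leadingCoeff_mul, (hpow q).2,
    HahnSeries.C_apply, HahnSeries.leadingCoeff_of_single, HahnSeries.leadingCoeff_of_single,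
    mul_one] at h2
  exact ⟨⟨f.order, by omega⟩, f.leadingCoeff, HahnSeries.leadingCoeff_ne_zero.2 hf, h2⟩

end LaurentSeries

/-! ### Valuations with independent slots -/

/-- A valuation ring over the constant field for which the slots have negative additive value,
independent modulo every `q`. -/
structure IsSlotValuation (F₀ : Type*) {F : Type*} [Field F₀] [Field F] [Algebra F₀ F] {m : ℕ}
    (α β : Fin m → F) (𝒪 : ValuationSubring F) : Prop where
  algebraMap_mem : ∀ c : F₀, algebraMap F₀ F c ∈ 𝒪
  α_notMem : ∀ j, α j ∉ 𝒪
  β_notMem : ∀ j, β j ∉ 𝒪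
  indep : ∀ (q : ℕ) (f : F), f ≠ 0 → ∀ a b : Fin m → ℤ,
    𝒪.valuation (f ^ q * ∏ j, (α j ^ a j * β j ^ b j)) = 1 →
      ∀ j, (q : ℤ) ∣ a j ∧ (q : ℤ) ∣ b j

namespace IsSlotValuation

variable {F₀ F : Type*} [Field F₀] [Field F] [Algebra F₀ F] {m : ℕ} {α β : Fin m → F}
  {𝒪 : ValuationSubring F}

theorem α_ne_zero (h : IsSlotValuation F₀ α β 𝒪) (j : Fin m) : α j ≠ 0 := fun h0 =>
  h.α_notMem j (h0 ▸ 𝒪.zero_mem)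

theorem β_ne_zero (h : IsSlotValuation F₀ α β 𝒪) (j : Fin m) : β j ≠ 0 := fun h0 =>
  h.β_notMem j (h0 ▸ 𝒪.zero_mem)

theorem valuation_algebraMap (h : IsSlotValuation F₀ α β 𝒪) {c : F₀} (hc : c ≠ 0) :
    𝒪.valuation (algebraMap F₀ F c) = 1 := by
  rw [𝒪.valuation_eq_one_iff_mem ((map_ne_zero _).2 hc), ← map_inv₀]
  exact ⟨h.algebraMap_mem _, h.algebraMap_mem _⟩

theorem infinite (h : IsSlotValuation F₀ α β 𝒪) (hm : 0 < m) : Infinite F := by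
  have h1 : 1 < 𝒪.valuation (α ⟨0, hm⟩) := by
    rw [← not_le, 𝒪.valuation_le_one_iff]
    exact h.α_notMem _
  refine Infinite.of_injective (fun n : ℕ => α ⟨0, hm⟩ ^ n) fun n n' hn => ?_
  have := congrArg 𝒪.valuation hn
  simp only [map_pow] at this
  exact (pow_right_strictMono₀ h1).injective this

end IsSlotValuation

theorem LaurentSeries.algebraMap_eq_C {F₀ K : Type*} [Field F₀] [Field K] [Algebra F₀ K] (c : F₀) :
    algebraMap F₀ (LaurentSeries K) c = HahnSeries.C (algebraMap F₀ K c) := by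
  rw [HahnSeries.algebraMap_apply', PowerSeries.algebraMap_apply, HahnSeries.ofPowerSeries_C]

/-- `compositeSubring_independent` is applied twice, first to the outer variable (new `β`), then to
the inner one (new `α`). -/
theorem IsSlotValuation.laurent {F₀ K : Type*} [Field F₀] [Field K] [Algebra F₀ K] {m : ℕ}
    {α β : Fin m → K} {𝒪 : ValuationSubring K} (h : IsSlotValuation F₀ α β 𝒪) :
    IsSlotValuation F₀
      (Fin.snoc (α := fun _ => LaurentSeries (LaurentSeries K))
        (fun i => HahnSeries.C (HahnSeries.C (α i))) (HahnSeries.C (HahnSeries.single (-1) 1)))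
      (Fin.snoc (α := fun _ => LaurentSeries (LaurentSeries K))
        (fun i => HahnSeries.C (HahnSeries.C (β i))) (HahnSeries.single (-1) 1))
      (LaurentSeries.compositeSubring (LaurentSeries.compositeSubring 𝒪)) := by
  let s : LaurentSeries K := HahnSeries.single (-1) 1
  let s' : LaurentSeries (LaurentSeries K) := HahnSeries.single (-1) 1
  let CC : K →+* LaurentSeries (LaurentSeries K) := HahnSeries.C.comp HahnSeries.C
  set α' : Fin (m + 1) → LaurentSeries (LaurentSeries K) := Fin.snoc
    (α := fun _ => LaurentSeries (LaurentSeries K))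
      (fun i => HahnSeries.C (HahnSeries.C (α i))) (HahnSeries.C (HahnSeries.single (-1) 1))
  set β' : Fin (m + 1) → LaurentSeries (LaurentSeries K) := Fin.snoc
    (α := fun _ => LaurentSeries (LaurentSeries K))
      (fun i => HahnSeries.C (HahnSeries.C (β i))) (HahnSeries.single (-1) 1)
  have hα : ∀ j : Fin m, α' j.castSucc = CC (α j) := fun j =>
    Fin.snoc_castSucc (α := fun _ => LaurentSeries (LaurentSeries K)) _ _ _
  have hβ : ∀ j : Fin m, β' j.castSucc = CC (β j) := fun j =>
    Fin.snoc_castSucc (α := fun _ => LaurentSeries (LaurentSeries K)) _ _ _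
  have hα' : α' (Fin.last m) = HahnSeries.C s :=
    Fin.snoc_last (α := fun _ => LaurentSeries (LaurentSeries K)) _ _
  have hβ' : β' (Fin.last m) = s' :=
    Fin.snoc_last (α := fun _ => LaurentSeries (LaurentSeries K)) _ _
  have hCC : ∀ c : K,
      CC c ∈ LaurentSeries.compositeSubring (LaurentSeries.compositeSubring 𝒪) ↔ c ∈ 𝒪 := fun c =>
    LaurentSeries.C_mem_compositeSubring_iff.trans LaurentSeries.C_mem_compositeSubring_iff
  refine ⟨fun c => by
    rw [LaurentSeries.algebraMap_eq_C, LaurentSeries.algebraMap_eq_C]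
    exact (hCC (algebraMap F₀ K c)).2 (h.algebraMap_mem c), fun j => ?_,
    fun j => ?_, fun q f hf a b hval => ?_⟩
  · induction j using Fin.lastCases with
    | last =>
      rw [hα']
      exact fun hmem => LaurentSeries.single_notMem_compositeSubring
        (LaurentSeries.C_mem_compositeSubring_iff.1 hmem)
    | cast j =>
      rw [hα]
      exact fun hmem => h.α_notMem j ((hCC _).1 hmem)
  · induction j using Fin.lastCases with
    | last =>
      rw [hβ']
      exact LaurentSeries.single_notMem_compositeSubring
    | cast j =>
      rw [hβ]
      exact fun hmem => h.β_notMem j ((hCC _).1 hmem)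
  · let Q : K := ∏ j : Fin m, (α j ^ a j.castSucc *
      β j ^ b j.castSucc)
    have hQ : Q ≠ 0 := Finset.prod_ne_zero_iff.2 fun j _ =>
      mul_ne_zero (zpow_ne_zero _ (h.α_ne_zero j)) (zpow_ne_zero _ (h.β_ne_zero j))
    have hs : s ≠ 0 := HahnSeries.single_ne_zero one_ne_zero
    have hprod : f ^ q * ∏ j, (α' j ^ a j * β' j ^ b j) =
        f ^ q * HahnSeries.C (HahnSeries.C Q * s ^ a (Fin.last m)) * s' ^ b (Fin.last m) := by
      rw [Fin.prod_univ_castSucc, hα', hβ', map_mul, map_zpow₀, mul_assoc, mul_assoc]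
      congr 2
      simp only [hα, hβ]
      change _ = CC Q
      rw [map_prod]
      exact Finset.prod_congr rfl fun j _ => by rw [map_mul, map_zpow₀, map_zpow₀]
    rw [hprod] at hval
    obtain ⟨hb, f', hf', hval'⟩ := LaurentSeries.compositeSubring_independent hf
      (mul_ne_zero (HahnSeries.C_ne_zero hQ) (zpow_ne_zero _ hs)) hval
    rw [← mul_assoc] at hval'
    obtain ⟨ha, f'', hf'', hval''⟩ := LaurentSeries.compositeSubring_independent hf' hQ hval'
    intro j
    induction j using Fin.lastCases with
    | last => exact ⟨ha, hb⟩
    | cast j => exact h.indep q f'' hf'' (fun j => a j.castSucc) (fun j => b j.castSucc) hval'' j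

/-- Independence for `q = 0` says that distinct monomials in the slots have distinct values;
constants have value `1`, so a nonzero polynomial has a unique dominant term. -/
theorem IsSlotValuation.aeval_injective {F₀ F : Type*} [Field F₀] [Field F] [Algebra F₀ F] {m : ℕ}
    {α β : Fin m → F} {𝒪 : ValuationSubring F} (h : IsSlotValuation F₀ α β 𝒪) :
    Function.Injective (MvPolynomial.aeval (R := F₀) (Sum.elim α β)) := by
  rw [injective_iff_map_eq_zero]
  intro P hP
  by_contra hne
  have hs : ∀ k, Sum.elim α β k ≠ 0 := by
    rintro (j | j)
    · exact h.α_ne_zero j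
    · exact h.β_ne_zero j
  let mon (d : Fin m ⊕ Fin m →₀ ℕ) : F := ∏ k, Sum.elim α β k ^ d k
  have hmon : ∀ d, mon d ≠ 0 := fun d => Finset.prod_ne_zero_iff.2 fun k _ => pow_ne_zero _ (hs k)
  let term (d : Fin m ⊕ Fin m →₀ ℕ) : F := algebraMap F₀ F (P.coeff d) * mon d
  have hterm : ∀ d ∈ P.support, 𝒪.valuation (term d) = 𝒪.valuation (mon d) := fun d hd => by
    rw [map_mul, h.valuation_algebraMap (MvPolynomial.mem_support_iff.1 hd), one_mul]
  have hinj : ∀ d d', 𝒪.valuation (mon d) = 𝒪.valuation (mon d') → d = d' := by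
    intro d d' hd
    have hz := h.indep 0 1 one_ne_zero (fun j => (d (Sum.inl j) : ℤ) - d' (Sum.inl j))
      (fun j => (d (Sum.inr j) : ℤ) - d' (Sum.inr j)) (by
        have e : ∏ j, (α j ^ ((d (Sum.inl j) : ℤ) - d' (Sum.inl j)) *
            β j ^ ((d (Sum.inr j) : ℤ) - d' (Sum.inr j))) = mon d / mon d' := by
          simp only [mon, Fintype.prod_sum_type, Sum.elim_inl, Sum.elim_inr,
            Finset.prod_mul_distrib, zpow_sub₀ (h.α_ne_zero _), zpow_sub₀ (h.β_ne_zero _),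
            zpow_natCast, Finset.prod_div_distrib, div_mul_div_comm]
        rw [pow_zero, one_mul, e, map_div₀, hd]
        exact div_self (𝒪.valuation.ne_zero_iff.2 (hmon d')))
    ext k
    rcases k with j | j
    · have := (hz j).1
      simp only [Nat.cast_zero, zero_dvd_iff] at this
      omega
    · have := (hz j).2
      simp only [Nat.cast_zero, zero_dvd_iff] at this
      omega
  obtain ⟨d, hd, hmax⟩ := Finset.exists_max_image P.support (fun d => 𝒪.valuation (term d))
    (MvPolynomial.support_nonempty.2 hne)
  have hsum : MvPolynomial.aeval (R := F₀) (Sum.elim α β) P = ∑ d ∈ P.support, term d := by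
    rw [MvPolynomial.aeval_def, MvPolynomial.eval₂_eq']
  have hd0 : 𝒪.valuation (term d) ≠ 0 := by
    rw [hterm d hd]
    exact 𝒪.valuation.ne_zero_iff.2 (hmon d)
  have hv : 𝒪.valuation (∑ d ∈ P.support, term d) = 𝒪.valuation (term d) := by
    classical
    refine 𝒪.valuation.map_sum_eq_of_lt hd fun d' hd' => ?_
    rw [Finset.mem_sdiff, Finset.mem_singleton] at hd'
    refine lt_of_le_of_ne (hmax d' hd'.1) fun heq => hd'.2 ?_
    rw [hterm d' hd'.1, hterm d hd] at heq
    exact hinj _ _ heq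
  rw [← hsum, hP, map_zero] at hv
  exact hd0 hv.symm

/-- A valuation as in `IsSlotValuation` on any field restricts to the rational function field. -/
theorem IsSlotValuation.exists_rational {F₀ F : Type*} [Field F₀] [Field F] [Algebra F₀ F] {m : ℕ}
    {α β : Fin m → F} {𝒪 : ValuationSubring F} (h : IsSlotValuation F₀ α β 𝒪) :
    ∃ 𝒪' : ValuationSubring (FractionRing (MvPolynomial (Fin m ⊕ Fin m) F₀)),
      IsSlotValuation F₀
        (fun i => algebraMap (MvPolynomial (Fin m ⊕ Fin m) F₀) _ (MvPolynomial.X (Sum.inl i)))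
        (fun i => algebraMap (MvPolynomial (Fin m ⊕ Fin m) F₀) _ (MvPolynomial.X (Sum.inr i)))
        𝒪' := by
  -- The slots are algebraically independent, so the rational function field embeds in `F` and the
  -- valuation ring is pulled back.
  let ψ : FractionRing (MvPolynomial (Fin m ⊕ Fin m) F₀) →+* F :=
    IsFractionRing.lift (A := MvPolynomial (Fin m ⊕ Fin m) F₀)
      (g := (MvPolynomial.aeval (R := F₀) (Sum.elim α β)).toRingHom) h.aeval_injective
  have hψ : ∀ P, ψ (algebraMap _ _ P) = MvPolynomial.aeval (R := F₀) (Sum.elim α β) P := fun P =>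
    IsFractionRing.lift_algebraMap _ _
  set α' : Fin m → FractionRing (MvPolynomial (Fin m ⊕ Fin m) F₀) :=
    fun i => algebraMap (MvPolynomial (Fin m ⊕ Fin m) F₀) _ (MvPolynomial.X (Sum.inl i))
  set β' : Fin m → FractionRing (MvPolynomial (Fin m ⊕ Fin m) F₀) :=
    fun i => algebraMap (MvPolynomial (Fin m ⊕ Fin m) F₀) _ (MvPolynomial.X (Sum.inr i))
  have hα : ∀ j, ψ (α' j) = α j := fun j => (hψ _).trans (MvPolynomial.aeval_X _ _)
  have hβ : ∀ j, ψ (β' j) = β j := fun j => (hψ _).trans (MvPolynomial.aeval_X _ _)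
  have hc : ∀ c, ψ (algebraMap F₀ _ c) = algebraMap F₀ F c := fun c =>
    (hψ (MvPolynomial.C c)).trans (MvPolynomial.aeval_C _ _)
  have hmem : ∀ x, x ∈ 𝒪.comap ψ ↔ ψ x ∈ 𝒪 := fun x => ValuationSubring.mem_comap
  refine ⟨𝒪.comap ψ, fun c => ?_, fun j => ?_, fun j => ?_, fun q f hf a b hval => ?_⟩
  · rw [hmem, hc]
    exact h.algebraMap_mem c
  · rw [hmem, hα]
    exact h.α_notMem j
  · rw [hmem, hβ]
    exact h.β_notMem j
  · refine h.indep q (ψ f) ((map_ne_zero ψ).2 hf) a b ?_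
    have e : ψ f ^ q * ∏ j, (α j ^ a j * β j ^ b j) =
        ψ (f ^ q * ∏ j, (α' j ^ a j * β' j ^ b j)) := by
      simp only [map_mul, map_pow, map_prod, map_zpow₀, hα, hβ]
    have hne : f ^ q * ∏ j, (α' j ^ a j * β' j ^ b j) ≠ 0 := by
      intro h0
      rw [h0, map_zero] at hval
      exact zero_ne_one hval
    rw [e, 𝒪.valuation_eq_one_iff_mem ((map_ne_zero ψ).2 hne), ← map_inv₀, ← hmem, ← hmem]
    exact ((𝒪.comap ψ).valuation_eq_one_iff_mem hne).1 hval

theorem SlotField.laurent_exists_isSlotValuation (F₀ : Type u) [Field F₀] (m : ℕ) :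
    ∃ 𝒪, IsSlotValuation F₀ (SlotField.laurent F₀ m).α (SlotField.laurent F₀ m).β 𝒪 := by
  induction m with
  | zero => exact ⟨⊤, fun _ => trivial, fun j => j.elim0, fun j => j.elim0,
      fun _ _ _ _ _ _ j => j.elim0⟩
  | succ m ih =>
    obtain ⟨𝒪, h⟩ := ih
    exact ⟨_, h.laurent⟩

theorem SlotField.rational_exists_isSlotValuation (F₀ : Type u) [Field F₀] (m : ℕ) :
    ∃ 𝒪, IsSlotValuation F₀ (SlotField.rational F₀ m).α (SlotField.rational F₀ m).β 𝒪 := by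
  obtain ⟨𝒪, h⟩ := SlotField.laurent_exists_isSlotValuation F₀ m
  exact h.exists_rational

/-! ### Assembly of the two cases -/

theorem natCast_ne_zero_of_lt {F₀ : Type*} [Field F₀] {p : ℕ}
    (hchar : ringChar F₀ = 0 ∨ p ≤ ringChar F₀) {k : ℕ} (hk : 0 < k) (hkp : k < p) :
    (k : F₀) ≠ 0 := by
  rw [Ne, ringChar.spec]
  intro hd
  rcases hchar with h | h
  · rw [h, zero_dvd_iff] at hd
    omega
  · have := Nat.le_of_dvd hk hd
    omega

/-- The `p`-th power of a relation among the values of `ξ`, `η` and `F` is one among the slots, up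
to a `p`-th power in `F`. For `ξ` only the equality of values is required, since in characteristic
`p` it is not a `p`-th root of `α`. -/
theorem SymbolRep.isTame_of_isSlotValuation {F₀ F K A : Type*} [Field F₀] [Field F] [Algebra F₀ F]
    [Field K] [Algebra F K] [Ring A] [Algebra F A] {p m : ℕ} [NeZero p] {α β : Fin m → F}
    {𝒪 : ValuationSubring F} (h : IsSlotValuation F₀ α β 𝒪) {B : ValuationSubring K}
    (hB : ∀ x, algebraMap F K x ∈ B ↔ x ∈ 𝒪) (R : SymbolRep p m F K A) (ξ : Fin m → K)
    (χ : AddChar (ZMod p) K)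
    (hξ : ∀ j, B.valuation (ξ j) ^ p = B.valuation (algebraMap F K (α j)))
    (hη : ∀ j, R.η j ^ p = algebraMap F K (β j))
    (hlt : ∀ j i, B.valuation (R.g j i - ξ j * χ i) < B.valuation (ξ j)) :
    R.IsTame B.valuation ξ χ where
  lt := hlt
  indep f hf n hn := by
    have hval : 𝒪.valuation (f ^ p * ∏ j, (α j ^ n (Sum.inl j) * β j ^ n (Sum.inr j))) = 1 := by
      have hne : f ^ p * ∏ j, (α j ^ n (Sum.inl j) * β j ^ n (Sum.inr j)) ≠ 0 :=
        mul_ne_zero (pow_ne_zero _ hf) (Finset.prod_ne_zero_iff.2 fun j _ =>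
          mul_ne_zero (zpow_ne_zero _ (h.α_ne_zero j)) (zpow_ne_zero _ (h.β_ne_zero j)))
      rw [𝒪.valuation_eq_one_iff_mem hne, ← hB, ← hB, map_inv₀,
        ← B.valuation_eq_one_iff_mem ((map_ne_zero _).2 hne)]
      have e := congrArg (· ^ p) hn
      simp only [one_pow, map_mul, map_prod, map_zpow₀, Fintype.prod_sum_type, Sum.elim_inl,
        Sum.elim_inr, mul_pow, ← Finset.prod_pow] at e
      rw [← e]
      simp only [map_mul, map_pow, map_prod, map_zpow₀, Finset.prod_mul_distrib, ← hξ, ← hη]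
      simp only [← zpow_natCast, zpow_comm _ (p : ℤ)]
    intro k
    rcases k with j | j
    · exact (h.indep p f hf _ _ hval j).1
    · exact (h.indep p f hf _ _ hval j).2

theorem SymbolRep.rank_le_of_charCoeff_eq_zero {F₀ F A : Type*} [Field F₀] [Field F] [Algebra F₀ F]
    [Ring A] [Algebra F A] {p m : ℕ} [Fact p.Prime]
    (hchar : ringChar F₀ = 0 ∨ p ≤ ringChar F₀) {α β : Fin m → F}
    {𝒪 : ValuationSubring F} (h : IsSlotValuation F₀ α β 𝒪)
    {B : ValuationSubring (AlgebraicClosure F)}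
    (hB : ∀ x, algebraMap F (AlgebraicClosure F) x ∈ B ↔ x ∈ 𝒪)
    (R : SymbolRep p m F (AlgebraicClosure F) A) {ξ : Fin m → AlgebraicClosure F}
    {χ : AddChar (ZMod p) (AlgebraicClosure F)} (hR : R.IsTame B.valuation ξ χ)
    {t₀ : ZMod p} {θ : F} (hθ : θ ≠ 0) (ht : ∀ j (a : ZMod p),
      ∑ i, R.g j i ^ a.val = if a = t₀ then algebraMap F (AlgebraicClosure F) θ else 0)
    (hχ : χ = 1 ∨ t₀ = 0) (V : Submodule F A)
    (hV : ∀ v ∈ V, ∀ i ∈ Finset.Icc 1 (p - 1), charCoeff F i v = 0) :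
    Module.rank F V ≤ (((p ^ (2 * m) - 1) / (p - 1) : ℕ) : Cardinal) := by
  have hp : p.Prime := Fact.out
  have h2 := hp.two_le
  obtain ⟨φ, hφ⟩ := R.exists_algEquiv
  have htrace := R.trace_toHom (R.trace_toHom_gen_of_sum ht)
  have hrange : ∀ a, (R.toHom a).trace ∈ (algebraMap F (AlgebraicClosure F)).range :=
    fun a => ⟨_, (htrace a).symm⟩
  have hrepr : ∀ a, (R.toHom a).trace = 0 → R.basis.repr a (Sum.elim (fun _ => t₀) 0) = 0 := by
    intro a ha
    rw [htrace, map_eq_zero] at ha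
    exact (mul_eq_zero.1 ha).resolve_right (pow_ne_zero _ hθ)
  -- For `m = 0` the field may be finite, so there is no polarization; but `A` is one-dimensional,
  -- and `f_1 = 0` forces `V = ⊥`.
  rcases Nat.eq_zero_or_pos m with rfl | hm
  · have hbot : V = ⊥ := by
      rw [eq_bot_iff]
      intro v hv
      have h0 := hrepr v (trace_eq_zero_of_charCoeff_one_eq_zero R.toHom φ hφ hrange
        (hV v hv 1 (Finset.mem_Icc.2 ⟨le_rfl, by omega⟩)))
      refine R.basis.repr.map_eq_zero_iff.1 (Finsupp.ext fun u => ?_)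
      rw [Subsingleton.elim u (Sum.elim (fun _ => t₀) 0), h0, Finsupp.zero_apply]
    subst hbot
    simp
  · have := h.infinite hm
    refine hR.rank_le (fun k hk hkp => ?_) (Sum.elim (fun _ => t₀) 0) ?_ V fun v hv => ?_
    · have hk0 : (k : F₀) ≠ 0 := natCast_ne_zero_of_lt hchar hk hkp
      have hv := h.valuation_algebraMap hk0
      rw [map_natCast] at hv
      have hkF : (k : F) ≠ 0 := by
        rw [← map_natCast (algebraMap F₀ F)]
        exact (map_ne_zero _).2 hk0
      rw [𝒪.valuation_eq_one_iff_mem hkF, ← hB, ← hB, map_inv₀,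
        ← B.valuation_eq_one_iff_mem ((map_ne_zero _).2 hkF), map_natCast] at hv
      exact hv
    · refine hχ.imp_right fun h0 => ?_
      subst h0
      funext k
      rcases k with j | j <;> rfl
    · refine hrepr _ (trace_pow_eq_zero_of_charCoeff_eq_zero hp R.toHom φ hφ hrange
        (fun k hk hkp => ?_) ?_ (hV v hv))
      · rw [← map_natCast (algebraMap F₀ F)]
        exact (map_ne_zero _).2 (natCast_ne_zero_of_lt hchar hk hkp)
      · rw [Fintype.card_fun, ZMod.card, Fintype.card_fin]
        exact Nat.le_self_pow hm.ne' p

/-- An Artin–Schreier root of an element with a pole has a pole itself, and `ξ ^ p` dominates `ξ`.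
-/
theorem ValuationSubring.valuation_pow_sub_self {K : Type*} [Field K] {p : ℕ} (hp : 2 ≤ p)
    (B : ValuationSubring K) {ξ : K} (h : ξ ^ p - ξ ∉ B) :
    1 < B.valuation ξ ∧ B.valuation ξ ^ p = B.valuation (ξ ^ p - ξ) := by
  have hξ : 1 < B.valuation ξ := by
    rw [← not_le, B.valuation_le_one_iff]
    exact fun hmem => h (sub_mem (pow_mem hmem p) hmem)
  refine ⟨hξ, ?_⟩
  rw [sub_eq_add_neg, B.valuation.map_add_eq_of_lt_left, map_pow]
  rw [Valuation.map_neg, map_pow]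
  exact lt_self_pow₀ hξ (by omega)

theorem rank_le_of_symbolAlgebra {F₀ : Type*} {F : Type u} [Field F₀] [Field F] [Algebra F₀ F]
    {p m : ℕ} [Fact p.Prime] (hchar : ringChar F₀ = 0 ∨ p ≤ ringChar F₀) {α β : Fin m → F}
    {𝒪 : ValuationSubring F} (h : IsSlotValuation F₀ α β 𝒪) (hne : ringChar F₀ ≠ p) {ρ : F₀}
    (hρ : IsPrimitiveRoot ρ p)
    (V : Submodule F (⨂[F] j, SymbolAlgebra p (algebraMap F₀ F ρ) (α j) (β j)))
    (hV : ∀ v ∈ V, ∀ i ∈ Finset.Icc 1 (p - 1), charCoeff F i v = 0) :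
    Module.rank F V ≤ (((p ^ (2 * m) - 1) / (p - 1) : ℕ) : Cardinal) := by
  have hp : p.Prime := Fact.out
  let K := AlgebraicClosure F
  have hζ : IsPrimitiveRoot (algebraMap F K (algebraMap F₀ F ρ)) p :=
    (hρ.map_of_injective (algebraMap F₀ F).injective).map_of_injective (algebraMap F K).injective
  let χ : AddChar (ZMod p) K := AddChar.zmodChar p hζ.pow_eq_one
  have hχ1 : χ 1 = algebraMap F K (algebraMap F₀ F ρ) := by
    have : Fact (1 < p) := ⟨hp.one_lt⟩
    rw [AddChar.zmodChar_apply, ZMod.val_one, pow_one]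
  have hχinj : Function.Injective χ := fun a b hab => by
    rw [AddChar.zmodChar_apply, AddChar.zmodChar_apply] at hab
    exact ZMod.val_injective p (hζ.pow_inj (ZMod.val_lt a) (ZMod.val_lt b) hab)
  have hχne : χ ≠ 1 := fun h1 => one_ne_zero (hχinj (a₁ := (1 : ZMod p)) (a₂ := 0) (by simp [h1]))
  choose ξ hξ using fun j => IsAlgClosed.exists_pow_nat_eq (algebraMap F K (α j)) hp.pos
  choose η hη using fun j => IsAlgClosed.exists_pow_nat_eq (algebraMap F K (β j)) hp.pos
  have hξ0 : ∀ j, ξ j ≠ 0 := fun j h0 => by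
    have := hξ j
    rw [h0, zero_pow hp.ne_zero, eq_comm, map_eq_zero] at this
    exact h.α_ne_zero j this
  have hη0 : ∀ j, η j ≠ 0 := fun j h0 => by
    have := hη j
    rw [h0, zero_pow hp.ne_zero, eq_comm, map_eq_zero] at this
    exact h.β_ne_zero j this
  choose ψ x y hx hy hspan using fun j =>
    SymbolAlgebra.exists_hom hp.two_le (hξ j) (hη j) χ hχ1
  let R : SymbolRep p m F K (⨂[F] j, SymbolAlgebra p (algebraMap F₀ F ρ) (α j) (β j)) :=
    SymbolRep.ofPi ψ x y hspan (fun j i => ξ j * χ i)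
      (fun j a b hab => hχinj (mul_left_cancel₀ (hξ0 j) hab)) η hη0 hx hy
  obtain ⟨B, hB⟩ := ValuationSubring.exists_extension (algebraMap F K) 𝒪
  have hR : R.IsTame B.valuation ξ χ :=
    R.isTame_of_isSlotValuation h hB ξ χ (fun j => by rw [← map_pow, hξ]) hη fun j i => by
      change B.valuation (ξ j * χ i - ξ j * χ i) < _
      rw [sub_self, map_zero]
      exact zero_lt_iff.2 (B.valuation.ne_zero_iff.2 (hξ0 j))
  have hp0 : (p : F) ≠ 0 := by
    rw [← map_natCast (algebraMap F₀ F)]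
    refine (map_ne_zero _).2 fun h0 => ?_
    rw [ringChar.spec, Nat.dvd_prime hp] at h0
    rcases h0 with h0 | h0
    · exact CharP.ringChar_ne_one h0
    · exact hne h0
  refine R.rank_le_of_charCoeff_eq_zero hchar h hB hR hp0 (t₀ := 0) (fun j a => ?_)
    (Or.inr rfl) V hV
  rw [map_natCast]
  exact sum_mul_addChar_pow (ξ j) hχne a

theorem rank_le_of_symbolAlgebraCharP {F₀ : Type*} {F : Type u} [Field F₀] [Field F] [Algebra F₀ F]
    {p m : ℕ} [Fact p.Prime] {α β : Fin m → F}
    {𝒪 : ValuationSubring F} (h : IsSlotValuation F₀ α β 𝒪) (hchar : ringChar F₀ = p)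
    (V : Submodule F (⨂[F] j, SymbolAlgebraCharP p (α j) (β j)))
    (hV : ∀ v ∈ V, ∀ i ∈ Finset.Icc 1 (p - 1), charCoeff F i v = 0) :
    Module.rank F V ≤ (((p ^ (2 * m) - 1) / (p - 1) : ℕ) : Cardinal) := by
  have hp : p.Prime := Fact.out
  let K := AlgebraicClosure F
  have : CharP F₀ p := ringChar.of_eq hchar
  have : CharP F p := charP_of_injective_algebraMap (algebraMap F₀ F).injective p
  have : CharP K p := charP_of_injective_algebraMap (algebraMap F K).injective p
  have hroot : ∀ a : K, ∃ z : K, z ^ p - z = a := by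
    intro a
    obtain ⟨z, hz⟩ := IsAlgClosed.exists_root (Polynomial.X ^ p - Polynomial.X - Polynomial.C a) (by
      have hd : (Polynomial.X + Polynomial.C a).degree <
          (Polynomial.X ^ p : Polynomial K).degree := by
        rw [Polynomial.degree_X_add_C, Polynomial.degree_X_pow]
        exact_mod_cast hp.one_lt
      rw [sub_sub, Polynomial.degree_sub_eq_left_of_degree_lt hd, Polynomial.degree_X_pow]
      exact_mod_cast hp.ne_zero)
    refine ⟨z, ?_⟩
    simpa [Polynomial.IsRoot, sub_eq_zero] using hz
  choose ξ hξ using fun j => hroot (algebraMap F K (α j))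
  choose η hη using fun j => IsAlgClosed.exists_pow_nat_eq (algebraMap F K (β j)) hp.pos
  have hη0 : ∀ j, η j ≠ 0 := fun j h0 => by
    have := hη j
    rw [h0, zero_pow hp.ne_zero, eq_comm, map_eq_zero] at this
    exact h.β_ne_zero j this
  choose ψ x y hx hy hspan using fun j => SymbolAlgebraCharP.exists_hom (hξ j) (hη j)
  let R : SymbolRep p m F K (⨂[F] j, SymbolAlgebraCharP p (α j) (β j)) :=
    SymbolRep.ofPi ψ x y hspan (fun j i => ξ j + ZMod.castHom dvd_rfl K i)
      (fun j a b hab => (ZMod.castHom (dvd_refl p) K).injective (add_left_cancel hab)) η hη0 hx hy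
  obtain ⟨B, hB⟩ := ValuationSubring.exists_extension (algebraMap F K) 𝒪
  have hval : ∀ j, 1 < B.valuation (ξ j) ∧
      B.valuation (ξ j) ^ p = B.valuation (algebraMap F K (α j)) := fun j => by
    rw [← hξ j]
    refine B.valuation_pow_sub_self hp.two_le ?_
    rw [hξ, hB]
    exact h.α_notMem j
  -- The eigenvalues `ξ j + i` have the common leading term `ξ j`, as `i` has value at most `1`; the
  -- leading character is thus trivial and the leading matrices commute.
  have hR : R.IsTame B.valuation ξ 1 :=
    R.isTame_of_isSlotValuation h hB ξ 1 (fun j => (hval j).2) hη fun j i => by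
      change B.valuation (ξ j + ZMod.castHom dvd_rfl K i - ξ j * 1) < _
      rw [mul_one, add_sub_cancel_left]
      refine lt_of_le_of_lt ((B.valuation_le_one_iff _).2 ?_) (hval j).1
      rw [← ZMod.natCast_zmod_val i, map_natCast]
      exact natCast_mem B _
  refine R.rank_le_of_charCoeff_eq_zero (Or.inr hchar.ge) h hB hR (t₀ := -1) (θ := -1)
    (neg_ne_zero.2 one_ne_zero) (fun j a => ?_) (Or.inl rfl) V hV
  rw [map_neg, map_one]
  exact sum_add_cast_pow (ξ j) a

theorem mainTheorem2 {F₀ : Type u} [Field F₀] (p : ℕ) (hp : p.Prime)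
    (hchar : ringChar F₀ = 0 ∨ p ≤ ringChar F₀) (m : ℕ) (F : SlotField F₀ m)
    (hF : F = SlotField.rational F₀ m ∨ F = SlotField.laurent F₀ m) :
    (ringChar F₀ ≠ p → ∀ ρ : F₀, IsPrimitiveRoot ρ p →
      ∀ V : Submodule F (⨂[F] j, SymbolAlgebra p (algebraMap F₀ F ρ) (F.α j) (F.β j)),
        (∀ v ∈ V, ∀ i ∈ Finset.Icc 1 (p - 1), charCoeff F i v = 0) →
          Module.rank F V ≤ (((p ^ (2 * m) - 1) / (p - 1) : ℕ) : Cardinal)) ∧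
    (ringChar F₀ = p →
      ∀ V : Submodule F (⨂[F] j, SymbolAlgebraCharP p (F.α j) (F.β j)),
        (∀ v ∈ V, ∀ i ∈ Finset.Icc 1 (p - 1), charCoeff F i v = 0) →
          Module.rank F V ≤ (((p ^ (2 * m) - 1) / (p - 1) : ℕ) : Cardinal)) := by
  have : Fact p.Prime := ⟨hp⟩
  obtain ⟨𝒪, h⟩ : ∃ 𝒪, IsSlotValuation F₀ F.α F.β 𝒪 := by
    rcases hF with rfl | rfl
    · exact SlotField.rational_exists_isSlotValuation F₀ m
    · exact SlotField.laurent_exists_isSlotValuation F₀ m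
  exact ⟨fun hne ρ hρ V hV => rank_le_of_symbolAlgebra hchar h hne hρ V hV,
    fun heq V hV => rank_le_of_symbolAlgebraCharP h heq V hV⟩
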